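/- Let $\Gamma$ be a finite connected simple graph. A (sub)graph is *leafless* if it has no vertex of valency $1$ and *nontrivial* if it has at least one edge. For a leafless subgraph $\Lambda\subset\Gamma$, its *orthogonal complement* $\Lambda^\perp$ is the subgraph obtained from the subgraph of $\Gamma$ induced on the vertices outside $\Lambda$ by iteratively deleting leaves and isolated vertices until stabilization. A leafless subgraph $\Lambda$ is *standard* if it is connected and nontrivial and $\Lambda^\perp$ is nontrivial; it is *maximally standard* if, in addition, $\Lambda^\perp$ is standard and $\Lambda=(\Lambda^\perp)^\perp$. Let $\mathcal S(\Gamma)$ (resp. $\mathcal M(\Gamma)$) be the graph whose vertices are the standard (resp. maximally standard) subgraphs of $\Gamma$, two distinct ones $\Lambda_1,\Lambda_2$ being adjacent if $\Lambda_1\subset\Lambda_2\cup\Lambda_2^\perp$ or $\Lambda_2\subset\Lambda_1\cup\Lambda_1^\perp$. The *curve graph* $\mathcal C(\Gamma)$ is the subgraph of $\mathcal S(\Gamma)$ induced on the cycles with nonempty orthogonal complement. Let $UD_2(\Gamma)$ be the unordered discrete $2$-configuration space of $\Gamma$, i.e. the square complex whose cells are the unordered pairs $\{\sigma,\tau\}$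 of disjoint closed cells (vertices or edges) of $\Gamma$. A *product structure* on a nonpositively curved square complex $X$ is a local isometry $\iota:\Lambda_1\times\Lambda_2\to X$ (a combinatorial map that is injective on the link of each vertex, with image an induced subcomplex of the link), where $\Lambda_1,\Lambda_2$ are connected nontrivial graphs, such that for some vertices $v_i\in\Lambda_i$ the map $\iota$ restricts to isomorphisms from $\Lambda_1\times\{v_2\}$ and $\{v_1\}\times\Lambda_2$ onto their images. A *standard product subcomplex* of $X$ is the image of a product structure with $\Lambda_1,\Lambda_2$ leafless; a *maximal product subcomplex* is a standard product subcomplex that is maximal under inclusion. The *intersection complex* $\mathcal I(X)$ has the maximal product subcomplexes as vertices, and each finite nonempty collection $\{M_0,\dots,M_n\}$ of them spans one $n$-simplex for every standard product subcomplex that is maximal among those contained in $M_0\cap\dots\cap M_n$. Then the following are equivalent: 1. $\mathcal C(\Gamma)$ is connected; 2. $\mathcal S(\Gamma)$ is connected; 3. $\mathcal M(\Gamma)$ is connected; 4. $\mathcal I(UD_2(\Gamma))$ is connected. The equivalence holds under either convention on whether an empty graph or complex counts as connected. -/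

import Mathlib

universe u

namespace GraphBraid

section Graphs

variable {V : Type u}

/-- A graph is leafless if it has no vertex of valency one. -/
def Leafless (G : SimpleGraph V) : Prop := ∀ v, ¬ ∃! w, G.Adj v w

/-- A graph is nontrivial if it has at least one edge. -/
def Nontriv (G : SimpleGraph V) : Prop := ∃ v w, G.Adj v w

variable {G : SimpleGraph V}

/-- A subgraph is leafless if none of its vertices has valency one in it
(isolated vertices are allowed). -/
def LeaflessSubgraph (H : G.Subgraph) : Prop := ∀ v, ¬ ∃! w, H.Adj v w

/-- A subgraph is nontrivial if it has at least one edge. -/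
def NontrivSubgraph (H : G.Subgraph) : Prop := ∃ v w, H.Adj v w

/-- Delete all leaves and all isolated vertices, that is, all vertices with at most one
neighbour. -/
def prune (H : G.Subgraph) : G.Subgraph :=
  H.deleteVerts {v | (H.neighborSet v).Subsingleton}

/-- The orthogonal complement of `H`: start from the graph `Γ ∖ H` induced on the vertices
outside `H`, and iterate the deletion of leaves and isolated vertices until stabilization. The
iterates form a decreasing sequence; in a finite graph it is eventually constant, and its infimum
is the stable value. -/
def ortho (H : G.Subgraph) : G.Subgraph :=
  ⨅ n : ℕ, prune^[n] ((⊤ : G.Subgraph).deleteVerts H.verts)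

/-- Standard subgraphs: leafless, connected, nontrivial, with nontrivial orthogonal complement. -/
structure IsStandard (H : G.Subgraph) : Prop where
  leafless : LeaflessSubgraph H
  connected : H.Connected
  nontriv : NontrivSubgraph H
  nontriv_ortho : NontrivSubgraph (ortho H)

/-- Maximally standard subgraphs. -/
structure IsMaximallyStandard (H : G.Subgraph) : Prop where
  standard : IsStandard H
  standard_ortho : IsStandard (ortho H)
  ortho_ortho : ortho (ortho H) = H

/-- The subgraph is a cycle, i.e. it is traced out by a closed walk without repetitions. -/
def IsCycleSubgraph (H : G.Subgraph) : Prop :=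
  ∃ (v : V) (p : G.Walk v v), p.IsCycle ∧ p.toSubgraph = H

variable (G)

/-- The graph `S(Γ)` of standard subgraphs: two distinct ones are adjacent when one of them
is contained in the union of the other with its orthogonal complement. -/
def standardGraph : SimpleGraph {H : G.Subgraph // IsStandard H} :=
  SimpleGraph.fromRel fun H₁ H₂ => H₁.1 ≤ H₂.1 ⊔ ortho H₂.1

/-- The graph `M(Γ)` of maximally standard subgraphs. -/
def maximallyStandardGraph : SimpleGraph {H : G.Subgraph // IsMaximallyStandard H} :=
  SimpleGraph.fromRel fun H₁ H₂ => H₁.1 ≤ H₂.1 ⊔ ortho H₂.1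

/-- The cycles with nonempty orthogonal complement, among the standard subgraphs. -/
def curves : Set {H : G.Subgraph // IsStandard H} :=
  {H | IsCycleSubgraph H.1 ∧ (ortho H.1).verts.Nonempty}

/-- The curve graph `C(Γ)`: the subgraph of `S(Γ)` induced on the cycles with nonempty
orthogonal complement. -/
def curveGraph : SimpleGraph (curves G) := (standardGraph G).induce (curves G)

end Graphs

section SquareComplexes

/-- A square complex whose cells are embedded and determined by their sets of vertices, given by
the family of vertex sets of its cells. A cell is a vertex, an edge, or a square; the faces of a
cell are the cells contained in it, and the edges of a square form a 4-cycle. The vertices are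
the points `x` with `{x} ∈ cells`. -/
structure SquareComplex (P : Type u) where
  cells : Set (Set P)
  vertex_mem : ∀ c ∈ cells, ∀ x ∈ c, {x} ∈ cells
  shape : ∀ c ∈ cells,
    (∃ x, c = {x}) ∨ (∃ x y, x ≠ y ∧ c = {x, y}) ∨
    ∃ x y z w, [x, y, z, w].Nodup ∧ c = {x, y, z, w} ∧
      {f | f ∈ cells ∧ f ⊆ c ∧ f.ncard = 2} = {{x, y}, {y, z}, {z, w}, {w, x}}

variable {P Q : Type u}

/-- `x` and `y` are the two ends of an edge. -/
def SquareComplex.Edge (X : SquareComplex P) (x y : P) : Prop :=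
  x ≠ y ∧ {x, y} ∈ X.cells

/-- Adjacency in the link of `x`: the edges from `x` to `y` and from `x` to `z` are
distinct and are sides of a common square. -/
def SquareComplex.LinkAdj (X : SquareComplex P) (x y z : P) : Prop :=
  y ≠ z ∧ X.Edge x y ∧ X.Edge x z ∧ ∃ c ∈ X.cells, c.ncard = 4 ∧ x ∈ c ∧ y ∈ c ∧ z ∈ c

/-- A combinatorial map: every cell is mapped bijectively onto a cell. -/
def IsCombinatorial (X : SquareComplex P) (Y : SquareComplex Q) (φ : P → Q) : Prop :=
  ∀ c ∈ X.cells, Set.InjOn φ c ∧ φ '' c ∈ Y.cells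

/-- A local isometry (of nonpositively curved square complexes, whose links are simple graphs):
a combinatorial map that is injective on the link of every vertex and whose image there is an
induced subcomplex of the link. -/
structure IsLocalIsometry (X : SquareComplex P) (Y : SquareComplex Q) (φ : P → Q) : Prop where
  combinatorial : IsCombinatorial X Y φ
  link_injective : ∀ x y z, X.Edge x y → X.Edge x z → φ y = φ z → y = z
  link_induced : ∀ x y z, X.Edge x y → X.Edge x z →
    Y.LinkAdj (φ x) (φ y) (φ z) → X.LinkAdj x y z

/-- The cells of a graph, as vertex sets: the vertices and the edges. -/
def graphCells (G : SimpleGraph P) : Set (Set P) :=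
  {c | (∃ v, c = {v}) ∨ ∃ v w, G.Adj v w ∧ c = {v, w}}

theorem singleton_mem_graphCells (G : SimpleGraph P) (v : P) : {v} ∈ graphCells G :=
  Or.inl ⟨v, rfl⟩

theorem prod_shape_aux (Λ₁ : SimpleGraph P) (Λ₂ : SimpleGraph Q) {f : Set (P × Q)}
    (hf : ∃ σ ∈ graphCells Λ₁, ∃ τ ∈ graphCells Λ₂, f = σ ×ˢ τ) (h2 : f.ncard = 2) :
    (∃ v p q, Λ₂.Adj p q ∧ f = {(v, p), (v, q)}) ∨
    (∃ v p q, Λ₁.Adj p q ∧ f = {(p, v), (q, v)}) := by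
  obtain ⟨σ, hσ, τ, hτ, rfl⟩ := hf
  rcases hσ with ⟨v, rfl⟩ | ⟨v, w, hvw, rfl⟩ <;> rcases hτ with ⟨p, rfl⟩ | ⟨p, q, hpq, rfl⟩
  · simp at h2
  · exact Or.inl ⟨v, p, q, hpq, by ext ⟨x, y⟩; simp; tauto⟩
  · exact Or.inr ⟨p, v, w, hvw, by ext ⟨x, y⟩; simp; tauto⟩
  · rw [Set.ncard_prod, Set.ncard_pair hvw.ne, Set.ncard_pair hpq.ne] at h2
    omega

/-- The product of two graphs, as a square complex: its cells are the products of cells. -/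
def prodComplex (Λ₁ : SimpleGraph P) (Λ₂ : SimpleGraph Q) : SquareComplex (P × Q) where
  cells := {c | ∃ σ ∈ graphCells Λ₁, ∃ τ ∈ graphCells Λ₂, c = σ ×ˢ τ}
  vertex_mem := by
    rintro _ - ⟨x, y⟩ -
    exact ⟨{x}, singleton_mem_graphCells _ x, {y}, singleton_mem_graphCells _ y, by simp⟩
  shape := by
    rintro c ⟨σ, hσ, τ, hτ, rfl⟩
    rcases hσ with ⟨v, rfl⟩ | ⟨v, w, hvw, rfl⟩ <;> rcases hτ with ⟨p, rfl⟩ | ⟨p, q, hpq, rfl⟩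
    · exact Or.inl ⟨(v, p), by simp⟩
    · exact Or.inr (Or.inl ⟨(v, p), (v, q), by simp [hpq.ne], by ext ⟨x, y⟩; simp; tauto⟩)
    · exact Or.inr (Or.inl ⟨(v, p), (w, p), by simp [hvw.ne], by ext ⟨x, y⟩; simp; tauto⟩)
    · have h1 := hvw.ne
      have h2 := hpq.ne
      refine Or.inr (Or.inr ⟨(v, p), (w, p), (w, q), (v, q), by simp [h1, h2, h1.symm],
        by ext ⟨x, y⟩; simp; tauto, ?_⟩)
      ext f
      constructor
      · rintro ⟨hf, hsub, hcard⟩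
        rcases prod_shape_aux Λ₁ Λ₂ hf hcard with ⟨a, b, c, hbc, rfl⟩ | ⟨a, b, c, hbc, rfl⟩
        · have h3 := hsub (Set.mem_insert _ _)
          have h4 := hsub (Set.mem_insert_of_mem _ (Set.mem_singleton _))
          have h5 := hbc.ne
          simp only [Set.mem_prod, Set.mem_insert_iff, Set.mem_singleton_iff] at h3 h4
          rcases h3 with ⟨rfl | rfl, rfl | rfl⟩ <;> rcases h4 with ⟨-, rfl | rfl⟩ <;>
            simp_all [Set.pair_comm]
        · have h3 := hsub (Set.mem_insert _ _)
          have h4 := hsub (Set.mem_insert_of_mem _ (Set.mem_singleton _))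
          have h5 := hbc.ne
          simp only [Set.mem_prod, Set.mem_insert_iff, Set.mem_singleton_iff] at h3 h4
          rcases h3 with ⟨rfl | rfl, rfl | rfl⟩ <;> rcases h4 with ⟨rfl | rfl, -⟩ <;>
            simp_all [Set.pair_comm]
      · have hA : ∀ x, ∃ σ ∈ graphCells Λ₁, ∃ τ ∈ graphCells Λ₂,
            ({(x, p), (x, q)} : Set (P × Q)) = σ ×ˢ τ := fun x =>
          ⟨{x}, singleton_mem_graphCells _ x, {p, q}, Or.inr ⟨p, q, hpq, rfl⟩,
            by ext ⟨x, y⟩; simp; tauto⟩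
        have hB : ∀ x, ∃ σ ∈ graphCells Λ₁, ∃ τ ∈ graphCells Λ₂,
            ({(v, x), (w, x)} : Set (P × Q)) = σ ×ˢ τ := fun x =>
          ⟨{v, w}, Or.inr ⟨v, w, hvw, rfl⟩, {x}, singleton_mem_graphCells _ x,
            by ext ⟨x, y⟩; simp; tauto⟩
        rintro (rfl | rfl | rfl | rfl)
        · exact ⟨hB p, by simp [Set.insert_subset_iff], Set.ncard_pair (by simp [h1])⟩
        · exact ⟨hA w, by simp [Set.insert_subset_iff], Set.ncard_pair (by simp [h2])⟩
        · rw [Set.pair_comm (w, q) (v, q)]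
          exact ⟨hB q, by simp [Set.insert_subset_iff], Set.ncard_pair (by simp [h1])⟩
        · rw [Set.pair_comm (v, q) (v, p)]
          exact ⟨hA v, by simp [Set.insert_subset_iff], Set.ncard_pair (by simp [h2])⟩

/-- The vertex set of the cell `{σ, τ}` of the unordered configuration space: all unordered pairs
`{x, y}` with `x ∈ σ` and `y ∈ τ`. -/
def pairCell (σ τ : Set P) : Set (Sym2 P) := {e | ∃ x ∈ σ, ∃ y ∈ τ, e = s(x, y)}

theorem pairCell_comm (σ τ : Set P) : pairCell σ τ = pairCell τ σ := by
  ext e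
  constructor <;> rintro ⟨x, hx, y, hy, rfl⟩ <;> exact ⟨y, hy, x, hx, Sym2.eq_swap⟩

theorem pairCell_singleton (x y : P) : pairCell {x} {y} = {s(x, y)} := by
  ext e; simp [pairCell]

theorem pairCell_edge (x p q : P) : pairCell {x} {p, q} = {s(x, p), s(x, q)} := by
  ext e; simp [pairCell]

theorem pairCell_square (v w p q : P) :
    pairCell {v, w} {p, q} = {s(v, p), s(w, p), s(w, q), s(v, q)} := by
  ext e; simp [pairCell]; tauto

/-- The cells of the unordered discrete 2-configuration space: the unordered pairs `{σ, τ}` of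
disjoint (closed) cells of the graph. -/
def configCells (G : SimpleGraph P) : Set (Set (Sym2 P)) :=
  {c | ∃ σ ∈ graphCells G, ∃ τ ∈ graphCells G, Disjoint σ τ ∧ c = pairCell σ τ}

theorem ncard_four {R : Type u} {x y z w : R} (h : [x, y, z, w].Nodup) :
    ({x, y, z, w} : Set R).ncard = 4 := by
  simp at h
  rw [Set.ncard_insert_of_notMem (by simp; tauto), Set.ncard_insert_of_notMem (by simp; tauto),
    Set.ncard_pair (by tauto)]

theorem config_nodup {v w p q : P} (h1 : v ≠ w) (h2 : p ≠ q)
    (hd : Disjoint ({v, w} : Set P) {p, q}) : [s(v, p), s(w, p), s(w, q), s(v, q)].Nodup := by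
  simp at hd
  simp
  grind

theorem config_shape_aux (G : SimpleGraph P) {f : Set (Sym2 P)}
    (hf : f ∈ configCells G) (h2 : f.ncard = 2) :
    ∃ v p q, G.Adj p q ∧ v ≠ p ∧ v ≠ q ∧ f = {s(v, p), s(v, q)} := by
  obtain ⟨σ, hσ, τ, hτ, hd, rfl⟩ := hf
  rcases hσ with ⟨v, rfl⟩ | ⟨v, w, hvw, rfl⟩ <;> rcases hτ with ⟨p, rfl⟩ | ⟨p, q, hpq, rfl⟩
  · simp [pairCell_singleton] at h2
  · simp at hd
    exact ⟨v, p, q, hpq, by grind, by grind, pairCell_edge v p q⟩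
  · simp at hd
    exact ⟨p, v, w, hvw, by grind, by grind, by rw [pairCell_comm, pairCell_edge]⟩
  · rw [pairCell_square, ncard_four (config_nodup hvw.ne hpq.ne hd)] at h2
    omega

theorem edge_mem_configCells (G : SimpleGraph P) {v p q : P} (h : G.Adj p q) (hp : v ≠ p)
    (hq : v ≠ q) : {s(v, p), s(v, q)} ∈ configCells G :=
  ⟨{v}, singleton_mem_graphCells _ v, {p, q}, Or.inr ⟨p, q, h, rfl⟩, by simp; grind,
    (pairCell_edge v p q).symm⟩

/-- The unordered discrete 2-configuration space of a graph, as a square complex. Its vertices are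
the unordered pairs of distinct vertices of the graph. -/
def UD₂ (G : SimpleGraph P) : SquareComplex (Sym2 P) where
  cells := configCells G
  vertex_mem := by
    rintro _ ⟨σ, -, τ, -, hd, rfl⟩ _ ⟨x, hx, y, hy, rfl⟩
    refine ⟨{x}, singleton_mem_graphCells _ x, {y}, singleton_mem_graphCells _ y, ?_,
      (pairCell_singleton x y).symm⟩
    simpa using Set.disjoint_left.1 hd |> fun h (e : x = y) => h hx (e ▸ hy)
  shape := by
    rintro c ⟨σ, hσ, τ, hτ, hd, rfl⟩
    rcases hσ with ⟨v, rfl⟩ | ⟨v, w, hvw, rfl⟩ <;> rcases hτ with ⟨p, rfl⟩ | ⟨p, q, hpq, rfl⟩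
    · exact Or.inl ⟨s(v, p), pairCell_singleton v p⟩
    · exact Or.inr (Or.inl ⟨s(v, p), s(v, q), fun h => hpq.ne (Sym2.congr_right.1 h), pairCell_edge v p q⟩)
    · exact Or.inr (Or.inl ⟨s(p, v), s(p, w), fun h => hvw.ne (Sym2.congr_right.1 h),
        by rw [pairCell_comm, pairCell_edge]⟩)
    · have h1 := hvw.ne
      have h2 := hpq.ne
      have hnd := config_nodup h1 h2 hd
      refine Or.inr (Or.inr ⟨s(v, p), s(w, p), s(w, q), s(v, q), hnd, pairCell_square v w p q, ?_⟩)
      simp at hd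
      obtain ⟨⟨ha, hb⟩, hc, hd⟩ := hd
      rw [pairCell_square]
      ext f
      constructor
      · rintro ⟨hf, hsub, hcard⟩
        obtain ⟨a, b, c, hbc, hab, hac, rfl⟩ := config_shape_aux G hf hcard
        have h3 := hsub (Set.mem_insert _ _)
        have h4 := hsub (Set.mem_insert_of_mem _ (Set.mem_singleton _))
        have h5 := hbc.ne
        clear hsub hcard hf hbc hnd
        simp only [Set.mem_insert_iff, Set.mem_singleton_iff, Sym2.eq_iff] at h3 h4
        have h6 : (a = v ∨ a = w) ∧ (b = p ∧ c = q ∨ b = q ∧ c = p) ∨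
            (a = p ∨ a = q) ∧ (b = v ∧ c = w ∨ b = w ∧ c = v) := by grind
        rcases h6 with ⟨rfl | rfl, ⟨rfl, rfl⟩ | ⟨rfl, rfl⟩⟩ | ⟨rfl | rfl, ⟨rfl, rfl⟩ | ⟨rfl, rfl⟩⟩
          <;> simp [Set.pair_comm, Sym2.eq_swap]
      · have hvp : v ≠ p := by grind
        have hvq : v ≠ q := by grind
        have hwp : w ≠ p := by grind
        have hwq : w ≠ q := by grind
        simp only [List.nodup_cons, List.mem_cons, not_or] at hnd
        rintro (rfl | rfl | rfl | rfl)
        · refine ⟨?_, by simp [Set.insert_subset_iff], Set.ncard_pair hnd.1.1⟩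
          rw [Sym2.eq_swap, Sym2.eq_swap (a := w)]
          exact edge_mem_configCells G hvw hvp.symm hwp.symm
        · exact ⟨edge_mem_configCells G hpq hwp hwq, by simp [Set.insert_subset_iff],
            Set.ncard_pair hnd.2.1.1⟩
        · refine ⟨?_, by simp [Set.insert_subset_iff], Set.ncard_pair hnd.2.2.1.1⟩
          rw [Sym2.eq_swap, Sym2.eq_swap (a := v)]
          exact edge_mem_configCells G hvw.symm hwq.symm hvq.symm
        · exact ⟨edge_mem_configCells G hpq.symm hvq hvp, by simp [Set.insert_subset_iff],
            Set.ncard_pair (Ne.symm hnd.1.2.2.1)⟩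

/-- A product structure on `X`: a local isometry from a product of two (connected, nontrivial)
graphs which restricts to isometries of the factors onto the images of a slice in each direction.
Since the cells of `X` are determined by their vertices, only graphs without loops and
multiple edges can occur as factors. -/
structure IsProductStructure {W₁ W₂ : Type u} (X : SquareComplex P) (Λ₁ : SimpleGraph W₁)
    (Λ₂ : SimpleGraph W₂) (ι : W₁ × W₂ → P) : Prop where
  connected₁ : Λ₁.Connected
  connected₂ : Λ₂.Connected
  nontriv₁ : Nontriv Λ₁
  nontriv₂ : Nontriv Λ₂
  localIsometry : IsLocalIsometry (prodComplex Λ₁ Λ₂) X ι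
  slices : ∃ (v₁ : W₁) (v₂ : W₂),
    Function.Injective (fun a => ι (a, v₂)) ∧ Function.Injective (fun b => ι (v₁, b))

/-- The image of a map of square complexes, as a set of cells of the target. -/
def imageCells (X : SquareComplex P) (φ : P → Q) : Set (Set Q) :=
  {d | ∃ c ∈ X.cells, d = φ '' c}

/-- Standard product subcomplexes (as sets of cells): the images of product structures whose
two factors are leafless. -/
def IsStandardProduct (X : SquareComplex P) (K : Set (Set P)) : Prop :=
  ∃ (W₁ W₂ : Type u) (Λ₁ : SimpleGraph W₁) (Λ₂ : SimpleGraph W₂) (ι : W₁ × W₂ → P),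
    IsProductStructure X Λ₁ Λ₂ ι ∧ Leafless Λ₁ ∧ Leafless Λ₂ ∧
    K = imageCells (prodComplex Λ₁ Λ₂) ι

/-- The maximal product subcomplexes: standard product subcomplexes that are maximal with respect
to inclusion. They are the vertices of the intersection complex. -/
def MaximalProduct (X : SquareComplex P) : Type u :=
  {M : Set (Set P) // Maximal (IsStandardProduct X) M}

/-- The simplices of the intersection complex `I(X)`. A finite nonempty set of maximal product
subcomplexes spans one simplex for each standard product subcomplex `core` that is maximal among
those contained in all of them. -/
structure IntersectionSimplex (X : SquareComplex P) where
  verts : Set (MaximalProduct X)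
  finite : verts.Finite
  nonempty : verts.Nonempty
  core : Set (Set P)
  core_maximal : Maximal (fun K => IsStandardProduct X K ∧ ∀ M ∈ verts, K ⊆ M.1) core

/-- The 1-skeleton of the intersection complex, with multiple edges identified. The
complex is connected if and only if this graph is. -/
def intersectionSkeleton (X : SquareComplex P) : SimpleGraph (MaximalProduct X) :=
  SimpleGraph.fromRel fun M N => ∃ s : IntersectionSimplex X, s.verts = {M, N}

end SquareComplexes

end GraphBraid

/-! Call a subgraph thick if it is connected and of minimum degree at least two. The complement
`Λ^⊥` is the largest subgraph of minimum degree two disjoint from `Λ` (`le_ortho`,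
`minDegreeTwo_ortho`), so `⊥` reverses inclusions. The key fact
(`isMaximallyStandard_of_isComponent`) is that every component of the complement of a thick subgraph
is maximally standard. Consequently two disjoint thick subgraphs always lie in `M` and `M^⊥` for
some maximally standard `M`.

A connected subgraph of `Λ ∪ Λ^⊥` lies in `Λ` or in `Λ^⊥`, so adjacency means nesting or
orthogonality, and connectedness can be carried between the graphs along inclusions. Two cycles in a
standard `Λ` are both orthogonal to a cycle in `Λ^⊥`; this compares `C(Γ)` with `S(Γ)`. Maximally
standard `M`, `N` containing the same thick `H` are joined through `M^⊥`, `N^⊥` and the components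
of `H^⊥` containing these; this compares `S(Γ)` with `M(Γ)`.

The standard product subcomplexes of `UD₂ G` are the products `A × B` of disjoint thick subgraphs
(`isStandardProduct_UD₂_iff`), and the maximal ones are the `M × M^⊥`. Hence `M ↦ M × M^⊥`
identifies `M` only with its neighbour `M^⊥`, and a product `A × B` common to two maximal products
places `A` inside one factor of each, which is the situation already treated. -/

namespace GraphBraid

/-! ### Thick subgraphs and the universal property of the orthogonal complement. -/

section Cores

variable {V : Type u} {G : SimpleGraph V}

/-- Every vertex of the subgraph has at least two neighbours in it. -/
def MinDegreeTwo (H : G.Subgraph) : Prop := ∀ v ∈ H.verts, (H.neighborSet v).Nontrivial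

/-- A connected subgraph all of whose vertices have valency at least two. -/
structure IsThick (H : G.Subgraph) : Prop where
  connected : H.Connected
  minDegreeTwo : MinDegreeTwo H

theorem MinDegreeTwo.leafless {H : G.Subgraph} (h : MinDegreeTwo H) : LeaflessSubgraph H := by
  rintro v ⟨w, hw, huniq⟩
  obtain ⟨x, hx, y, hy, hxy⟩ := h v (H.edge_vert hw)
  exact hxy ((huniq x hx).trans (huniq y hy).symm)

theorem MinDegreeTwo.nontriv {H : G.Subgraph} (h : MinDegreeTwo H) (hne : H.verts.Nonempty) :
    NontrivSubgraph H := by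
  obtain ⟨v, hv⟩ := hne
  obtain ⟨x, hx, -⟩ := h v hv
  exact ⟨v, x, hx⟩

/-- A connected graph with an edge has no isolated vertex, so excluding valency one leaves valency
at least two. -/
theorem isThick_iff {H : G.Subgraph} :
    IsThick H ↔ LeaflessSubgraph H ∧ H.Connected ∧ NontrivSubgraph H := by
  constructor
  · intro h
    exact ⟨h.minDegreeTwo.leafless, h.connected, h.minDegreeTwo.nontriv h.connected.nonempty⟩
  · rintro ⟨hl, hc, a, b, hab⟩
    refine ⟨hc, fun v hv => ?_⟩
    have : Nontrivial H.verts :=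
      ⟨⟨a, H.edge_vert hab⟩, ⟨b, H.edge_vert hab.symm⟩, fun h => hab.ne (congrArg Subtype.val h)⟩
    obtain ⟨w, hw⟩ := hc.preconnected.exists_adj_of_nontrivial ⟨v, hv⟩
    by_contra hsub
    rw [Set.not_nontrivial_iff] at hsub
    exact hl v ⟨w, hw, fun y hy => hsub hy hw⟩

theorem isStandard_iff {H : G.Subgraph} :
    IsStandard H ↔ IsThick H ∧ NontrivSubgraph (ortho H) := by
  rw [isThick_iff]
  exact ⟨fun h => ⟨⟨h.1, h.2, h.3⟩, h.4⟩, fun h => ⟨h.1.1, h.1.2.1, h.1.2.2, h.2⟩⟩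

theorem IsStandard.isThick {H : G.Subgraph} (h : IsStandard H) : IsThick H :=
  (isStandard_iff.1 h).1

theorem prune_le (H : G.Subgraph) : prune H ≤ H := SimpleGraph.Subgraph.deleteVerts_le

theorem prune_mono_of_minDegreeTwo {H K : G.Subgraph} (hK : MinDegreeTwo K) (h : K ≤ H) :
    K ≤ prune H := by
  have key : ∀ v ∈ K.verts, v ∈ H.verts ∧ ¬ (H.neighborSet v).Subsingleton := fun v hv =>
    ⟨h.1 hv, Set.not_subsingleton_iff.2 ((hK v hv).mono fun w hw => h.2 hw)⟩
  refine ⟨fun v hv => key v hv, fun v w hvw => ?_⟩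
  exact SimpleGraph.Subgraph.deleteVerts_adj.2 ⟨(key v (K.edge_vert hvw)).1,
    (key v (K.edge_vert hvw)).2, (key w (K.edge_vert hvw.symm)).1,
    (key w (K.edge_vert hvw.symm)).2, h.2 hvw⟩

theorem ortho_le_deleteVerts (H : G.Subgraph) :
    ortho H ≤ (⊤ : G.Subgraph).deleteVerts H.verts := iInf_le _ 0

theorem disjoint_verts_ortho (H : G.Subgraph) : Disjoint (ortho H).verts H.verts :=
  Set.disjoint_left.2 fun _ hv => ((ortho_le_deleteVerts H).1 hv).2

/-- Pruning never removes a vertex that has two neighbours in `K`. Together with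
`minDegreeTwo_ortho` this characterizes `ortho H`; the pruning process itself is not needed
afterwards. -/
theorem le_ortho {H K : G.Subgraph} (hK : MinDegreeTwo K) (hd : Disjoint K.verts H.verts) :
    K ≤ ortho H := by
  refine le_iInf fun n => ?_
  induction n with
  | zero =>
    refine ⟨fun v hv => ⟨trivial, Set.disjoint_left.1 hd hv⟩, fun v w hvw => ?_⟩
    exact SimpleGraph.Subgraph.deleteVerts_adj.2 ⟨trivial,
      Set.disjoint_left.1 hd (K.edge_vert hvw), trivial,
      Set.disjoint_left.1 hd (K.edge_vert hvw.symm), hvw.adj_sub⟩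
  | succ n ih =>
    rw [Function.iterate_succ_apply']
    exact prune_mono_of_minDegreeTwo hK ih

/-- By finiteness the infimum is one of the iterates, and a fixed point of `prune` has no vertex of
valency at most one. -/
theorem minDegreeTwo_ortho [Finite V] (H : G.Subgraph) : MinDegreeTwo (ortho H) := by
  set f : ℕ → G.Subgraph := fun n => prune^[n] ((⊤ : G.Subgraph).deleteVerts H.verts) with hf
  have hanti : Antitone f := antitone_nat_of_succ_le fun n => by
    simp only [hf, Function.iterate_succ_apply']
    exact prune_le _
  obtain ⟨n, hn'⟩ : ∃ n, ∀ m, n ≤ m → f n = f m :=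
    WellFoundedGT.monotone_chain_condition
      (α := G.Subgraphᵒᵈ) ⟨fun n => OrderDual.toDual (f n), fun _ _ h => hanti h⟩
  have heq : ortho H = f n := by
    refine le_antisymm (iInf_le _ n) (le_iInf fun m => ?_)
    rcases le_total n m with h | h
    · exact (hn' m h).le
    · exact hanti h
  have hfix : prune (f n) = f n := by
    have := hn' (n + 1) (Nat.le_succ n)
    simp only [hf, Function.iterate_succ_apply'] at this
    exact this.symm
  intro v hv
  rw [heq] at hv ⊢
  rw [← hfix] at hv
  exact Set.not_subsingleton_iff.1 hv.2

theorem ortho_anti [Finite V] {H K : G.Subgraph} (h : H.verts ⊆ K.verts) : ortho K ≤ ortho H :=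
  le_ortho (minDegreeTwo_ortho K) ((disjoint_verts_ortho K).mono_right h)

theorem exists_walk_first_hit {S : Set V} {x y : V} (p : G.Walk x y) (hy : y ∈ S) :
    ∃ z ∈ S, ∃ q : G.Walk x z, ∀ w ∈ q.support, w ∈ S → w = z := by
  induction p with
  | nil => exact ⟨_, hy, .nil, by simp⟩
  | @cons a b c h p ih =>
    by_cases ha : a ∈ S
    · exact ⟨a, ha, .nil, by simp⟩
    · obtain ⟨z, hz, q, hq⟩ := ih hy
      refine ⟨z, hz, .cons h q, fun w hw hwS => ?_⟩
      rcases List.mem_cons.1 hw with rfl | hw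
      · exact absurd hwS ha
      · exact hq w hw hwS

theorem exists_path_first_hit (hG : G.Connected) {S : Set V} {x y : V} (hy : y ∈ S) :
    ∃ z ∈ S, ∃ q : G.Walk x z, q.IsPath ∧ ∀ w ∈ q.support, w ∈ S → w = z := by
  classical
  obtain ⟨p⟩ := hG.preconnected x y
  obtain ⟨z, hz, q, hq⟩ := exists_walk_first_hit p hy
  exact ⟨z, hz, q.bypass, q.bypass_isPath, fun w hw => hq w (q.support_bypass_subset_support hw)⟩

/-- Two thick subgraphs joined by a path form a thick subgraph. -/
theorem IsThick.sup_path {A B : G.Subgraph} (hA : IsThick A) (hB : IsThick B) {a b : V}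
    (ha : a ∈ A.verts) (hb : b ∈ B.verts) {p : G.Walk a b} (hp : p.IsPath) :
    IsThick (A ⊔ p.toSubgraph ⊔ B) := by
  refine ⟨?_, ?_⟩
  · refine SimpleGraph.Subgraph.connected_sup (SimpleGraph.Subgraph.connected_sup
      hA.connected.preconnected p.toSubgraph_connected.preconnected
      ⟨a, ha, p.start_mem_verts_toSubgraph⟩).preconnected hB.connected.preconnected
      ⟨b, Or.inr p.end_mem_verts_toSubgraph, hb⟩
  · rintro v ((hv | hv) | hv)
    · exact (hA.minDegreeTwo v hv).mono fun w hw => Or.inl (Or.inl hw)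
    · rw [p.mem_verts_toSubgraph, SimpleGraph.Walk.mem_support_iff_exists_getVert] at hv
      obtain ⟨i, rfl, hi⟩ := hv
      -- An end of the path has its two neighbours in `A` or in `B`; an interior vertex has two on
      -- the path itself.
      rcases Nat.eq_zero_or_pos i with rfl | h0
      · simp only [SimpleGraph.Walk.getVert_zero]
        exact (hA.minDegreeTwo a ha).mono fun w hw => Or.inl (Or.inl hw)
      · rcases hi.eq_or_lt with rfl | hlt
        · simp only [SimpleGraph.Walk.getVert_length]
          exact (hB.minDegreeTwo b hb).mono fun w hw => Or.inr hw
        · have h2 := hp.ncard_neighborSet_toSubgraph_internal_eq_two h0.ne' hlt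
          exact (Set.one_lt_ncard_iff_nontrivial_and_finite.1 (h2 ▸ one_lt_two)).1.mono
            fun w hw => Or.inl (Or.inr hw)
    · exact (hB.minDegreeTwo v hv).mono fun w hw => Or.inr hw

/-! ### Components of orthogonal complements are maximally standard. -/

/-- `L` is a connected component of `K`: a maximal connected subgraph of it. -/
def IsComponent (K L : G.Subgraph) : Prop :=
  Maximal (fun D : G.Subgraph => D.Connected ∧ D ≤ K) L

theorem exists_isComponent_ge [Finite V] {K C : G.Subgraph} (hC : C.Connected) (h : C ≤ K) :
    ∃ L, C ≤ L ∧ IsComponent K L :=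
  (Set.toFinite {D : G.Subgraph | D.Connected ∧ D ≤ K}).exists_le_maximal ⟨hC, h⟩

theorem exists_isComponent_mem [Finite V] {K : G.Subgraph} {x : V} (hx : x ∈ K.verts) :
    ∃ L, x ∈ L.verts ∧ IsComponent K L := by
  obtain ⟨L, hL, h⟩ := exists_isComponent_ge
    (SimpleGraph.Subgraph.singletonSubgraph_connected (G := G) (v := x))
    (SimpleGraph.singletonSubgraph_le_iff x K |>.2 hx)
  exact ⟨L, hL.1 rfl, h⟩

theorem IsComponent.le_of_mem {K L D : G.Subgraph} (hL : IsComponent K L) (hD : D.Connected)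
    (hDK : D ≤ K) {x : V} (hxD : x ∈ D.verts) (hxL : x ∈ L.verts) : D ≤ L :=
  le_sup_right.trans (hL.2 ⟨SimpleGraph.Subgraph.connected_sup hL.1.1.preconnected hD.preconnected
    ⟨x, hxL, hxD⟩, sup_le hL.1.2 hDK⟩ le_sup_left)

theorem IsComponent.adj {K L : G.Subgraph} (hL : IsComponent K L) {v w : V} (hv : v ∈ L.verts)
    (h : K.Adj v w) : L.Adj v w := by
  have hle : G.subgraphOfAdj h.adj_sub ≤ L :=
    hL.le_of_mem (SimpleGraph.Subgraph.subgraphOfAdj_connected _)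
      (SimpleGraph.subgraphOfAdj_le_of_adj K h) (x := v) (by simp) hv
  exact hle.2 (by simp)

theorem IsComponent.isThick {K L : G.Subgraph} (hL : IsComponent K L) (hK : MinDegreeTwo K) :
    IsThick L :=
  ⟨hL.1.1, fun v hv => (hK v (hL.1.2.1 hv)).mono fun _ hw => hL.adj hv hw⟩

theorem IsThick.le_ortho_of_isComponent {H L : G.Subgraph} (hH : IsThick H)
    (hL : IsComponent (ortho H) L) : H ≤ ortho L :=
  le_ortho hH.minDegreeTwo ((disjoint_verts_ortho H).symm.mono_right hL.1.2.1)

/-- In a connected graph, the orthogonal complement of a component of the orthogonal complement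
of a thick subgraph is connected. -/
theorem connected_ortho_of_isComponent [Finite V] (hG : G.Connected) {H L : G.Subgraph}
    (hH : IsThick H) (hL : IsComponent (ortho H) L) : (ortho L).Connected := by
  have hLt := hL.isThick (minDegreeTwo_ortho H)
  have hLH : Disjoint L.verts H.verts := (disjoint_verts_ortho H).mono_left hL.1.2.1
  -- `N` is the component of `ortho L` containing `H`; the aim is that it contains every vertex of
  -- `ortho L`.
  obtain ⟨N, hHN, hN⟩ := exists_isComponent_ge hH.connected (hH.le_ortho_of_isComponent hL)
  obtain ⟨h, hh⟩ := hH.connected.nonempty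
  have hsub : ∀ x ∈ (ortho L).verts, x ∈ N.verts := by
    intro x hx
    obtain ⟨D, hxD, hD⟩ := exists_isComponent_mem hx
    have hDt := hD.isThick (minDegreeTwo_ortho L)
    have hDL : Disjoint D.verts L.verts := (disjoint_verts_ortho L).mono_left hD.1.2.1
    by_cases hDH : Disjoint D.verts H.verts
    · obtain ⟨z, hz, q, hq, hfirst⟩ :=
        exists_path_first_hit hG (S := H.verts ∪ L.verts) (x := x) (Or.inl hh)
      -- If the path from `D` meets `H` first, then `D`, the path and `H` form a thick subgraph
      -- missing `L`, which therefore lies in `N`. If it meets `L` first, then `D`, the path and `L`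
      -- lie in `ortho H`, hence in `L`, although `D` is disjoint from `L`.
      rcases hz with hz | hz
      · have ht := hDt.sup_path hH hxD hz hq
        have hle : D ⊔ q.toSubgraph ⊔ H ≤ ortho L := by
          refine le_ortho ht.minDegreeTwo (Set.disjoint_left.2 ?_)
          rintro w ((hw | hw) | hw) hwL
          · exact Set.disjoint_left.1 hDL hw hwL
          · rw [q.mem_verts_toSubgraph] at hw
            obtain rfl := hfirst w hw (Or.inr hwL)
            exact Set.disjoint_left.1 hLH hwL hz
          · exact Set.disjoint_left.1 hLH hwL hw
        exact (hN.le_of_mem ht.connected hle (x := h) (Or.inr hh) (hHN.1 hh)).1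
          (Or.inl (Or.inl hxD))
      · have ht := hDt.sup_path hLt hxD hz hq
        have hle : D ⊔ q.toSubgraph ⊔ L ≤ ortho H := by
          refine le_ortho ht.minDegreeTwo (Set.disjoint_left.2 ?_)
          rintro w ((hw | hw) | hw) hwH
          · exact Set.disjoint_left.1 hDH hw hwH
          · rw [q.mem_verts_toSubgraph] at hw
            obtain rfl := hfirst w hw (Or.inl hwH)
            exact Set.disjoint_left.1 hLH hz hwH
          · exact Set.disjoint_left.1 hLH hw hwH
        exact absurd ((hL.le_of_mem ht.connected hle (x := z) (Or.inr hz) hz).1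
          (Or.inl (Or.inl hxD))) (Set.disjoint_left.1 hDL hxD)
    · obtain ⟨y, hyD, hyH⟩ := Set.not_disjoint_iff.1 hDH
      exact (hN.le_of_mem hD.1.1 hD.1.2 hyD (hHN.1 hyH)).1 hxD
  have heq : N = ortho L :=
    le_antisymm hN.1.2 ⟨hsub, fun v w hvw => hN.adj (hsub v ((ortho L).edge_vert hvw)) hvw⟩
  exact heq ▸ hN.1.1

/-- Since `H ≤ ortho L`, the double complement lies in `ortho H`, so a component of it that meets
`L` stays in `L`. One that misses `L` would lie in `ortho L`, from which the double complement is
disjoint. -/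
theorem ortho_ortho_of_isComponent [Finite V] {H L : G.Subgraph} (hH : IsThick H)
    (hL : IsComponent (ortho H) L) : ortho (ortho L) = L := by
  have hLt := hL.isThick (minDegreeTwo_ortho H)
  have hle : ortho (ortho L) ≤ ortho H := ortho_anti (hH.le_ortho_of_isComponent hL).1
  have hsub : ∀ x ∈ (ortho (ortho L)).verts, x ∈ L.verts := by
    intro x hx
    obtain ⟨D, hxD, hD⟩ := exists_isComponent_mem hx
    by_cases hDL : Disjoint D.verts L.verts
    · have := (le_ortho (hD.isThick (minDegreeTwo_ortho _)).minDegreeTwo hDL).1 hxD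
      exact absurd this (Set.disjoint_left.1 (disjoint_verts_ortho (ortho L)) hx)
    · obtain ⟨y, hyD, hyL⟩ := Set.not_disjoint_iff.1 hDL
      exact (hL.le_of_mem hD.1.1 (hD.1.2.trans hle) hyD hyL).1 hxD
  have hle' : ortho (ortho L) ≤ L :=
    ⟨hsub, fun v w hvw => hL.adj (hsub v (SimpleGraph.Subgraph.edge_vert _ hvw)) (hle.2 hvw)⟩
  exact le_antisymm hle' (le_ortho hLt.minDegreeTwo (disjoint_verts_ortho L).symm)

/-- The nontriviality of both complements is automatic: `H` and `ortho H` are complements of each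
other and thick. -/
theorem isMaximallyStandard_iff {H : G.Subgraph} :
    IsMaximallyStandard H ↔ IsThick H ∧ IsThick (ortho H) ∧ ortho (ortho H) = H := by
  constructor
  · exact fun h => ⟨h.1.isThick, h.2.isThick, h.3⟩
  · rintro ⟨h1, h2, h3⟩
    have n1 := (isThick_iff.1 h1).2.2
    have n2 := (isThick_iff.1 h2).2.2
    exact ⟨isStandard_iff.2 ⟨h1, n2⟩, isStandard_iff.2 ⟨h2, h3.symm ▸ n1⟩, h3⟩

theorem IsMaximallyStandard.ortho {H : G.Subgraph} (h : IsMaximallyStandard H) :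
    IsMaximallyStandard (ortho H) :=
  ⟨h.2, h.3.symm ▸ h.1, congrArg _ h.3⟩

theorem isMaximallyStandard_of_isComponent [Finite V] (hG : G.Connected) {H L : G.Subgraph}
    (hH : IsThick H) (hL : IsComponent (ortho H) L) : IsMaximallyStandard L :=
  isMaximallyStandard_iff.2 ⟨hL.isThick (minDegreeTwo_ortho H),
    ⟨connected_ortho_of_isComponent hG hH hL, minDegreeTwo_ortho L⟩,
    ortho_ortho_of_isComponent hH hL⟩

/-- A connected subgraph of the union of two disjoint subgraphs lies in one of them. -/
theorem le_or_le_of_le_sup {A B C : G.Subgraph} (hA : A.Connected) (h : A ≤ B ⊔ C)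
    (hd : Disjoint C.verts B.verts) : A ≤ B ∨ A ≤ C := by
  -- No edge crosses between the disjoint `B` and `C`, so membership in `B` is constant along walks
  -- in `A`.
  have hstep : ∀ {v w}, A.Adj v w → (v ∈ B.verts ↔ w ∈ B.verts) := by
    intro v w hvw
    rcases h.2 hvw with h' | h'
    · exact ⟨fun _ => B.edge_vert h'.symm, fun _ => B.edge_vert h'⟩
    · exact ⟨fun hv => absurd hv (Set.disjoint_left.1 hd (C.edge_vert h')),
        fun hw => absurd hw (Set.disjoint_left.1 hd (C.edge_vert h'.symm))⟩
  have hwalk : ∀ {v w : A.verts}, A.coe.Walk v w → ((v : V) ∈ B.verts ↔ (w : V) ∈ B.verts) := by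
    intro v w p
    induction p with
    | nil => rfl
    | cons hadj _ ih => exact (hstep hadj).trans ih
  obtain ⟨x, hx⟩ := hA.nonempty
  have hall : ∀ v ∈ A.verts, (v ∈ B.verts ↔ x ∈ B.verts) := fun v hv => by
    obtain ⟨p⟩ := hA.coe.preconnected ⟨v, hv⟩ ⟨x, hx⟩
    exact hwalk p
  by_cases hxB : x ∈ B.verts
  · refine Or.inl ⟨fun v hv => (hall v hv).2 hxB, fun v w hvw => ?_⟩
    exact (h.2 hvw).resolve_right fun h' =>
      Set.disjoint_left.1 hd (C.edge_vert h') ((hall v (A.edge_vert hvw)).2 hxB)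
  · have hB : ∀ v ∈ A.verts, v ∉ B.verts := fun v hv h' => hxB ((hall v hv).1 h')
    refine Or.inr ⟨fun v hv => (h.1 hv).resolve_left (hB v hv), fun v w hvw => ?_⟩
    exact (h.2 hvw).resolve_left fun h' => hB v (A.edge_vert hvw) (B.edge_vert h')

theorem isThick_of_isCycle {v : V} {p : G.Walk v v} (hp : p.IsCycle) : IsThick p.toSubgraph := by
  refine ⟨p.toSubgraph_connected, fun w hw => ?_⟩
  rw [p.mem_verts_toSubgraph] at hw
  have := hp.ncard_neighborSet_toSubgraph_eq_two hw
  exact (Set.one_lt_ncard_iff_nontrivial_and_finite.1 (this ▸ one_lt_two)).1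

/-- Otherwise `H` is a finite tree with an edge, and such a tree has a leaf. -/
theorem IsThick.exists_cycle_le [Finite V] {H : G.Subgraph} (h : IsThick H) :
    ∃ C, IsCycleSubgraph C ∧ C ≤ H := by
  classical
  by_cases hac : H.coe.IsAcyclic
  · exfalso
    have := Fintype.ofFinite V
    obtain ⟨a, b, hab⟩ := (isThick_iff.1 h).2.2
    have : Nontrivial H.verts :=
      ⟨⟨a, H.edge_vert hab⟩, ⟨b, H.edge_vert hab.symm⟩, fun h => hab.ne (congrArg Subtype.val h)⟩
    have htree : H.coe.IsTree := ⟨h.connected.coe, hac⟩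
    obtain ⟨v, hv⟩ := htree.exists_vert_degree_one_of_nontrivial
    obtain ⟨w, -, hw⟩ :=
      (SimpleGraph.degree_eq_one_iff_existsUnique_adj (G := H.coe) (v := v)).1 (by convert hv)
    obtain ⟨x, hx, y, hy, hxy⟩ := h.minDegreeTwo v v.2
    have h1 := hw ⟨x, H.edge_vert hx.symm⟩ hx
    have h2 := hw ⟨y, H.edge_vert hy.symm⟩ hy
    exact hxy (congrArg Subtype.val (h1.trans h2.symm))
  · simp only [SimpleGraph.IsAcyclic, not_forall, not_not] at hac
    obtain ⟨v, c, hc⟩ := hac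
    refine ⟨_, ⟨H.hom v, c.map H.hom, hc.map H.hom_injective, rfl⟩, ?_⟩
    rw [SimpleGraph.Walk.toSubgraph_map]
    refine ⟨?_, ?_⟩
    · rintro _ ⟨x, -, rfl⟩
      exact x.2
    · rintro _ _ ⟨x, y, hxy, rfl, rfl⟩
      exact hxy.adj_sub

end Cores

end GraphBraid

namespace GraphBraid

/-! ### Transfer of connectedness between graphs. -/

section Transfer

/-- Connectedness passes along a correspondence between the vertices of two graphs which relates
neighbouring (or equal) vertices to vertices in the same component. -/
theorem preconnected_of_correspondence {α β : Type*} {X : SimpleGraph α} {Y : SimpleGraph β}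
    (R : α → β → Prop) (hβ : ∀ b, ∃ a, R a b)
    (hsame : ∀ a b b', R a b → R a b' → Y.Reachable b b')
    (hadj : ∀ a a', X.Adj a a' → ∃ b b', R a b ∧ R a' b' ∧ Y.Reachable b b')
    (hX : X.Preconnected) : Y.Preconnected := by
  have hwalk : ∀ {a a'}, X.Walk a a' → ∀ b b', R a b → R a' b' → Y.Reachable b b' := by
    intro a a' p
    induction p with
    | nil => exact fun b b' => hsame _ b b'
    | cons h _ ih =>
      intro b b' hb hb'
      obtain ⟨c, c', hc, hc', hcc⟩ := hadj _ _ h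
      exact ((hsame _ _ _ hb hc).trans hcc).trans (ih c' b' hc' hb')
  intro b b'
  obtain ⟨a, ha⟩ := hβ b
  obtain ⟨a', ha'⟩ := hβ b'
  obtain ⟨p⟩ := hX a a'
  exact hwalk p b b' ha ha'

theorem reachable_fromRel {α : Type*} {r : α → α → Prop} {a b : α} (h : r a b) :
    (SimpleGraph.fromRel r).Reachable a b := by
  by_cases hab : a = b
  · exact hab ▸ SimpleGraph.Reachable.refl _
  · exact SimpleGraph.Adj.reachable ((SimpleGraph.fromRel_adj r a b).2 ⟨hab, Or.inl h⟩)

/-- `Preconnected` admits the empty graph and `Connected` does not, so comparing nonemptiness passes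
from one convention to the other. -/
theorem connected_iff_of_preconnected_iff {α β : Type*} {X : SimpleGraph α} {Y : SimpleGraph β}
    (hXY : X.Preconnected ↔ Y.Preconnected) (hne : Nonempty α ↔ Nonempty β) :
    X.Connected ↔ Y.Connected := by
  rw [SimpleGraph.connected_iff, SimpleGraph.connected_iff, hXY, hne]

end Transfer

/-! ### The curve graph, the standard graph and the maximally standard graph. -/

section StandardGraphs

variable {V : Type u} {G : SimpleGraph V}

theorem IsThick.le_or_le_ortho {A B : G.Subgraph} (hA : IsThick A) (h : A ≤ B ⊔ ortho B) :
    A ≤ B ∨ A ≤ ortho B :=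
  le_or_le_of_le_sup hA.connected h (disjoint_verts_ortho B)

theorem IsThick.le_ortho_symm {A B : G.Subgraph} (hB : IsThick B) (h : A ≤ ortho B) :
    B ≤ ortho A :=
  le_ortho hB.minDegreeTwo ((disjoint_verts_ortho B).symm.mono_right h.1)

theorem MinDegreeTwo.ortho_nontriv_of_le {A B : G.Subgraph} (hB : MinDegreeTwo B)
    (hd : Disjoint B.verts A.verts) (hne : B.verts.Nonempty) : NontrivSubgraph (ortho A) := by
  obtain ⟨v, w, hvw⟩ := hB.nontriv hne
  exact ⟨v, w, (le_ortho hB hd).2 hvw⟩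

theorem IsCycleSubgraph.isThick {C : G.Subgraph} (h : IsCycleSubgraph C) : IsThick C := by
  obtain ⟨v, p, hp, rfl⟩ := h
  exact isThick_of_isCycle hp

theorem reachable_standardGraph_of_le {H K : {H : G.Subgraph // IsStandard H}} (h : H.1 ≤ K.1) :
    (standardGraph G).Reachable H K :=
  reachable_fromRel (h.trans le_sup_left)

theorem reachable_standardGraph_of_adj {H K : {H : G.Subgraph // IsStandard H}}
    (h : H.1 ≤ K.1 ⊔ ortho K.1) : (standardGraph G).Reachable H K :=
  reachable_fromRel h

/-- Thickness splits each inclusion in two, and orthogonality is symmetric, so three of the four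
cases remain. -/
theorem adj_cases {H K : G.Subgraph} (hH : IsThick H) (hK : IsThick K)
    (h : H ≤ K ⊔ ortho K ∨ K ≤ H ⊔ ortho H) : H ≤ K ∨ K ≤ H ∨ H ≤ ortho K := by
  rcases h with h | h
  · rcases hH.le_or_le_ortho h with h | h
    · exact Or.inl h
    · exact Or.inr (Or.inr h)
  · rcases hK.le_or_le_ortho h with h | h
    · exact Or.inr (Or.inl h)
    · exact Or.inr (Or.inr (hH.le_ortho_symm h))

theorem reachable_curveGraph_of_le_ortho {C D : curves G} (h : C.1.1 ≤ ortho D.1.1) :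
    (curveGraph G).Reachable C D := by
  by_cases hCD : C = D
  · exact hCD ▸ SimpleGraph.Reachable.refl _
  · refine SimpleGraph.Adj.reachable ?_
    refine SimpleGraph.induce_adj.2 <| (SimpleGraph.fromRel_adj _ _ _).2
      ⟨fun h => hCD (Subtype.ext h), Or.inl ?_⟩
    exact h.trans le_sup_right

/-- A cycle in a thick subgraph that is disjoint from another thick subgraph, as a curve. -/
theorem exists_curve_le {H K : G.Subgraph} [Finite V] (hH : IsThick H) (hK : MinDegreeTwo K)
    (hne : K.verts.Nonempty) (hd : Disjoint H.verts K.verts) : ∃ C : curves G, C.1.1 ≤ H := by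
  obtain ⟨C, hC, hCH⟩ := hH.exists_cycle_le
  have hd' : Disjoint K.verts C.verts := hd.symm.mono_right hCH.1
  exact ⟨⟨⟨C, isStandard_iff.2 ⟨hC.isThick, hK.ortho_nontriv_of_le hd' hne⟩⟩, hC,
    hne.mono (le_ortho hK hd').1⟩, hCH⟩

theorem IsStandard.ortho_nonempty {H : G.Subgraph} (h : IsStandard H) :
    (ortho H).verts.Nonempty := by
  obtain ⟨v, w, hvw⟩ := h.nontriv_ortho
  exact ⟨v, (ortho H).edge_vert hvw⟩

theorem reachable_maximallyStandardGraph_ortho (M N : {H : G.Subgraph // IsMaximallyStandard H})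
    (h : M.1 ≤ ortho N.1) : (maximallyStandardGraph G).Reachable M N :=
  reachable_fromRel (h.trans le_sup_right)

theorem reachable_maximallyStandardGraph_of_le
    (M N : {H : G.Subgraph // IsMaximallyStandard H})
    (h : M.1 ≤ N.1) : (maximallyStandardGraph G).Reachable M N :=
  reachable_fromRel (h.trans le_sup_left)

/-- The orthogonal complement as a map on maximally standard subgraphs. -/
def IsMaximallyStandard.perp (M : {H : G.Subgraph // IsMaximallyStandard H}) :
    {H : G.Subgraph // IsMaximallyStandard H} := ⟨GraphBraid.ortho M.1, M.2.ortho⟩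

variable [Finite V]

theorem IsStandard.exists_curve_le {H : G.Subgraph} (h : IsStandard H) :
    ∃ C : curves G, C.1.1 ≤ H :=
  GraphBraid.exists_curve_le h.isThick (minDegreeTwo_ortho H) h.ortho_nonempty
    (disjoint_verts_ortho H).symm

theorem IsStandard.exists_curve_le_ortho {H : G.Subgraph} (h : IsStandard H) :
    ∃ C : curves G, C.1.1 ≤ GraphBraid.ortho H := by
  obtain ⟨x, hx⟩ := h.ortho_nonempty
  -- The complement `ortho H` need not be connected, so the cycle is sought in one component.
  obtain ⟨L, -, hL⟩ := exists_isComponent_mem hx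
  obtain ⟨C, hC⟩ := GraphBraid.exists_curve_le (hL.isThick (minDegreeTwo_ortho H))
    h.isThick.minDegreeTwo h.isThick.connected.nonempty
    ((disjoint_verts_ortho H).mono_left hL.1.2.1)
  exact ⟨C, hC.trans hL.1.2⟩

/-- A cycle in `ortho H` is orthogonal to every cycle in `H`, hence links `C` to `D`. -/
theorem reachable_curveGraph_of_le {H : G.Subgraph} (hH : IsStandard H) {C D : curves G}
    (hC : C.1.1 ≤ H) (hD : D.1.1 ≤ H) : (curveGraph G).Reachable C D := by
  obtain ⟨E, hE⟩ := hH.exists_curve_le_ortho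
  have key : ∀ F : curves G, F.1.1 ≤ H → (curveGraph G).Reachable E F := fun F hF =>
    reachable_curveGraph_of_le_ortho (hE.trans (ortho_anti hF.1))
  exact (key C hC).symm.trans (key D hD)

theorem curveGraph_preconnected_iff :
    (curveGraph G).Preconnected ↔ (standardGraph G).Preconnected := by
  constructor
  · refine preconnected_of_correspondence (fun C H => C.1.1 ≤ H.1)
      (fun H => H.2.exists_curve_le) (fun C H K hH hK => ?_) (fun C D h => ?_)
    · exact (reachable_standardGraph_of_le (H := C.1) hH).symm.trans
        (reachable_standardGraph_of_le (H := C.1) hK)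
    · exact ⟨C.1, D.1, le_rfl, le_rfl, SimpleGraph.Adj.reachable h⟩
  · refine preconnected_of_correspondence (fun H C => C.1.1 ≤ H.1) (fun C => ⟨C.1, le_rfl⟩)
      (fun H C D => reachable_curveGraph_of_le H.2) (fun H K h => ?_)
    obtain ⟨C, hC⟩ := H.2.exists_curve_le
    obtain ⟨D, hD⟩ := K.2.exists_curve_le
    refine ⟨C, D, hC, hD, ?_⟩
    -- For nested subgraphs both cycles lie in the larger one; for orthogonal subgraphs the cycles
    -- are orthogonal.
    rcases adj_cases H.2.isThick K.2.isThick ((SimpleGraph.fromRel_adj _ _ _).1 h).2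
      with h | h | h
    · exact reachable_curveGraph_of_le K.2 (hC.trans h) hD
    · exact reachable_curveGraph_of_le H.2 hC (hD.trans h)
    · exact reachable_curveGraph_of_le_ortho (hC.trans (h.trans (ortho_anti hD.1)))

theorem nonempty_curves_iff :
    Nonempty (curves G) ↔ Nonempty {H : G.Subgraph // IsStandard H} :=
  ⟨fun ⟨C⟩ => ⟨C.1⟩, fun ⟨H⟩ => ⟨H.2.exists_curve_le.choose⟩⟩

/-- Take `M = ortho L` for the component `L` of `ortho A` containing `B`; then `ortho M = L`. -/
theorem exists_isMaximallyStandard_of_isThick (hG : G.Connected) {A B : G.Subgraph}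
    (hA : IsThick A) (hB : IsThick B) (hd : Disjoint A.verts B.verts) :
    ∃ M : {H : G.Subgraph // IsMaximallyStandard H}, A ≤ M.1 ∧ B ≤ ortho M.1 := by
  obtain ⟨L, hBL, hL⟩ := exists_isComponent_ge hB.connected (le_ortho hB.minDegreeTwo hd.symm)
  have hLm := isMaximallyStandard_of_isComponent hG hA hL
  exact ⟨⟨ortho L, hLm.ortho⟩, hA.le_ortho_of_isComponent hL, hBL.trans hLm.ortho_ortho.ge⟩

theorem IsStandard.exists_isMaximallyStandard_ge (hG : G.Connected) {H : G.Subgraph}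
    (hH : IsStandard H) : ∃ M : {H : G.Subgraph // IsMaximallyStandard H}, H ≤ M.1 := by
  obtain ⟨x, hx⟩ := hH.ortho_nonempty
  obtain ⟨L, -, hL⟩ := exists_isComponent_mem hx
  obtain ⟨M, hM, -⟩ := exists_isMaximallyStandard_of_isThick hG hH.isThick
    (hL.isThick (minDegreeTwo_ortho H)) ((disjoint_verts_ortho H).symm.mono_right hL.1.2.1)
  exact ⟨M, hM⟩

/-- All maximally standard subgraphs containing a given thick subgraph lie in one component. -/
theorem reachable_maximallyStandardGraph_of_ge (hG : G.Connected) {H : G.Subgraph}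
    (hH : IsThick H) (M N : {H : G.Subgraph // IsMaximallyStandard H}) (hM : H ≤ M.1)
    (hN : H ≤ N.1) : (maximallyStandardGraph G).Reachable M N := by
  -- Pass from `K` to `ortho K`, which is connected and inside `ortho H`, and then to the component
  -- of `ortho H` containing it.
  have key : ∀ K : {H : G.Subgraph // IsMaximallyStandard H}, H ≤ K.1 →
      ∃ L, ∃ hL : IsComponent (ortho H) L, (maximallyStandardGraph G).Reachable
        ⟨L, isMaximallyStandard_of_isComponent hG hH hL⟩ K := by
    intro K hK
    obtain ⟨L, hKL, hL⟩ := exists_isComponent_ge K.2.ortho.1.connected (ortho_anti hK.1)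
    refine ⟨L, hL, SimpleGraph.Reachable.trans ?_
      (reachable_maximallyStandardGraph_ortho (IsMaximallyStandard.perp K) K le_rfl)⟩
    exact (reachable_maximallyStandardGraph_of_le (IsMaximallyStandard.perp K)
      ⟨L, isMaximallyStandard_of_isComponent hG hH hL⟩ hKL).symm
  obtain ⟨L, hL, hLM⟩ := key M hM
  obtain ⟨L', hL', hLN⟩ := key N hN
  refine (hLM.symm.trans ?_).trans hLN
  -- Disjoint components are orthogonal; components that meet are nested.
  by_cases hd : Disjoint L.verts L'.verts
  · exact reachable_maximallyStandardGraph_ortho _ _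
      (le_ortho (hL.isThick (minDegreeTwo_ortho H)).minDegreeTwo hd)
  · obtain ⟨x, hx, hx'⟩ := Set.not_disjoint_iff.1 hd
    exact reachable_maximallyStandardGraph_of_le _ _ (hL'.le_of_mem hL.1.1 hL.1.2 hx hx')

theorem standardGraph_preconnected_iff (hG : G.Connected) :
    (standardGraph G).Preconnected ↔ (maximallyStandardGraph G).Preconnected := by
  constructor
  · refine preconnected_of_correspondence (fun H M => H.1 ≤ M.1)
      (fun M => ⟨⟨M.1, M.2.1⟩, le_rfl⟩)
      (fun H M N => reachable_maximallyStandardGraph_of_ge hG H.2.isThick M N)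
      (fun H K h => ?_)
    rcases adj_cases H.2.isThick K.2.isThick ((SimpleGraph.fromRel_adj _ _ _).1 h).2
      with h | h | h
    · obtain ⟨M, hM⟩ := K.2.exists_isMaximallyStandard_ge hG
      exact ⟨M, M, h.trans hM, hM, SimpleGraph.Reachable.refl _⟩
    · obtain ⟨M, hM⟩ := H.2.exists_isMaximallyStandard_ge hG
      exact ⟨M, M, hM, h.trans hM, SimpleGraph.Reachable.refl _⟩
    -- An orthogonal pair enlarges to a pair `M`, `ortho M`, whose members are linked.
    · obtain ⟨M, hHM, hKM⟩ := exists_isMaximallyStandard_of_isThick hG H.2.isThick K.2.isThick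
        ((disjoint_verts_ortho K.1).mono_left h.1)
      exact ⟨M, IsMaximallyStandard.perp M, hHM, hKM,
        (reachable_maximallyStandardGraph_ortho (IsMaximallyStandard.perp M) M le_rfl).symm⟩
  · refine preconnected_of_correspondence (fun M H => H.1 ≤ M.1)
      (fun H => H.2.exists_isMaximallyStandard_ge hG)
      (fun M H K hH hK => ?_) (fun M N h => ?_)
    · exact (reachable_standardGraph_of_le (K := ⟨M.1, M.2.1⟩) hH).trans
        (reachable_standardGraph_of_le (K := ⟨M.1, M.2.1⟩) hK).symm
    · refine ⟨⟨M.1, M.2.1⟩, ⟨N.1, N.2.1⟩, le_rfl, le_rfl, ?_⟩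
      rcases ((SimpleGraph.fromRel_adj _ _ _).1 h).2 with h | h
      · exact reachable_standardGraph_of_adj h
      · exact (reachable_standardGraph_of_adj (H := ⟨N.1, N.2.1⟩) (K := ⟨M.1, M.2.1⟩) h).symm

theorem nonempty_standard_iff (hG : G.Connected) :
    Nonempty {H : G.Subgraph // IsStandard H} ↔
      Nonempty {H : G.Subgraph // IsMaximallyStandard H} :=
  ⟨fun ⟨H⟩ => ⟨(H.2.exists_isMaximallyStandard_ge hG).choose⟩, fun ⟨M⟩ => ⟨⟨M.1, M.2.1⟩⟩⟩

end StandardGraphs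

end GraphBraid

namespace GraphBraid

/-! ### Products of disjoint subgraphs inside the configuration space. -/

section Products

variable {V : Type u} {G : SimpleGraph V}

/-- The cells of a subgraph, as vertex sets. -/
def subgraphCells (A : G.Subgraph) : Set (Set V) :=
  {c | (∃ v ∈ A.verts, c = {v}) ∨ ∃ v w, A.Adj v w ∧ c = {v, w}}

/-- The subcomplex of the configuration space given by one point in each of two subgraphs. -/
def productCells (A B : G.Subgraph) : Set (Set (Sym2 V)) :=
  {c | ∃ σ ∈ subgraphCells A, ∃ τ ∈ subgraphCells B, c = pairCell σ τ}

theorem productCells_comm (A B : G.Subgraph) : productCells A B = productCells B A := by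
  ext c
  constructor <;> rintro ⟨σ, hσ, τ, hτ, rfl⟩ <;> exact ⟨τ, hτ, σ, hσ, pairCell_comm σ τ⟩

theorem subgraphCells_subset_verts {A : G.Subgraph} {σ : Set V} (h : σ ∈ subgraphCells A) :
    σ ⊆ A.verts := by
  rcases h with ⟨v, hv, rfl⟩ | ⟨v, w, hvw, rfl⟩
  · simpa using hv
  · simp [Set.insert_subset_iff, A.edge_vert hvw, A.edge_vert hvw.symm]

theorem subgraphCells_subset_graphCells (A : G.Subgraph) : subgraphCells A ⊆ graphCells G := by
  rintro σ (⟨v, -, rfl⟩ | ⟨v, w, hvw, rfl⟩)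
  · exact Or.inl ⟨v, rfl⟩
  · exact Or.inr ⟨v, w, hvw.adj_sub, rfl⟩

theorem subgraphCells_nonempty {A : G.Subgraph} {σ : Set V} (h : σ ∈ subgraphCells A) :
    σ.Nonempty := by
  rcases h with ⟨v, -, rfl⟩ | ⟨v, w, -, rfl⟩
  · exact Set.singleton_nonempty v
  · exact Set.insert_nonempty v _

theorem subgraphCells_mono {A B : G.Subgraph} (h : A ≤ B) :
    subgraphCells A ⊆ subgraphCells B := by
  rintro σ (⟨v, hv, rfl⟩ | ⟨v, w, hvw, rfl⟩)
  · exact Or.inl ⟨v, h.1 hv, rfl⟩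
  · exact Or.inr ⟨v, w, h.2 hvw, rfl⟩

theorem productCells_mono {A B A' B' : G.Subgraph} (hA : A ≤ A') (hB : B ≤ B') :
    productCells A B ⊆ productCells A' B' := by
  rintro _ ⟨σ, hσ, τ, hτ, rfl⟩
  exact ⟨σ, subgraphCells_mono hA hσ, τ, subgraphCells_mono hB hτ, rfl⟩

theorem adj_of_pair_mem_subgraphCells {A : G.Subgraph} {v w : V} (hne : v ≠ w)
    (h : {v, w} ∈ subgraphCells A) : A.Adj v w := by
  rcases h with ⟨x, -, hx⟩ | ⟨x, y, hxy, heq⟩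
  · have h1 : v ∈ ({x} : Set V) := hx ▸ Set.mem_insert v _
    have h2 : w ∈ ({x} : Set V) := hx ▸ Set.mem_insert_of_mem _ rfl
    exact absurd (h1.trans h2.symm) hne
  · rcases Set.pair_eq_pair_iff.1 heq with ⟨rfl, rfl⟩ | ⟨rfl, rfl⟩
    · exact hxy
    · exact hxy.symm

theorem mk_mem_pairCell {σ τ : Set V} {x y : V} :
    s(x, y) ∈ pairCell σ τ ↔ x ∈ σ ∧ y ∈ τ ∨ x ∈ τ ∧ y ∈ σ := by
  constructor
  · rintro ⟨a, ha, b, hb, h⟩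
    rcases Sym2.eq_iff.1 h with ⟨rfl, rfl⟩ | ⟨rfl, rfl⟩
    · exact Or.inl ⟨ha, hb⟩
    · exact Or.inr ⟨hb, ha⟩
  · rintro (⟨hx, hy⟩ | ⟨hx, hy⟩)
    · exact ⟨x, hx, y, hy, rfl⟩
    · exact ⟨y, hy, x, hx, Sym2.eq_swap⟩

/-- Placing `x` in `σ'` and `y` in `τ'` fixes the order: by disjointness no other pair containing
`x` or `y` can match the wrong way round. -/
theorem subset_of_pairCell_subset {σ τ σ' τ' : Set V} (h : pairCell σ τ ⊆ pairCell σ' τ')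
    (hd : Disjoint σ' τ') {x y : V} (hx : x ∈ σ) (hx' : x ∈ σ') (hy : y ∈ τ) (hy' : y ∈ τ') :
    σ ⊆ σ' ∧ τ ⊆ τ' := by
  have hx'' := Set.disjoint_left.1 hd hx'
  have hy'' := Set.disjoint_right.1 hd hy'
  constructor
  · intro z hz
    rcases mk_mem_pairCell.1 (h (mk_mem_pairCell.2 (Or.inl ⟨hz, hy⟩))) with h | h
    · exact h.1
    · exact absurd h.2 hy''
  · intro z hz
    rcases mk_mem_pairCell.1 (h (mk_mem_pairCell.2 (Or.inl ⟨hx, hz⟩))) with h | h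
    · exact h.2
    · exact absurd h.1 hx''

theorem pairCell_inj {σ τ σ' τ' : Set V} (h : pairCell σ τ = pairCell σ' τ')
    (hd : Disjoint σ τ) (hd' : Disjoint σ' τ') (hσ : σ.Nonempty) (hτ : τ.Nonempty) :
    σ = σ' ∧ τ = τ' ∨ σ = τ' ∧ τ = σ' := by
  obtain ⟨x, hx⟩ := hσ
  obtain ⟨y, hy⟩ := hτ
  have key : ∀ {α β : Set V}, pairCell σ τ = pairCell α β → Disjoint α β → x ∈ α → y ∈ β →
      σ = α ∧ τ = β := by
    intro α β h hαβ hxα hyβ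
    have h1 := subset_of_pairCell_subset h.subset hαβ hx hxα hy hyβ
    have h2 := subset_of_pairCell_subset h.superset hd hxα hx hyβ hy
    exact ⟨h1.1.antisymm h2.1, h1.2.antisymm h2.2⟩
  have hmem : s(x, y) ∈ pairCell σ' τ' := h ▸ mk_mem_pairCell.2 (Or.inl ⟨hx, hy⟩)
  rcases mk_mem_pairCell.1 hmem with ⟨h1, h2⟩ | ⟨h1, h2⟩
  · exact Or.inl (key h hd' h1 h2)
  · exact Or.inr (key (h.trans (pairCell_comm _ _)) hd'.symm h1 h2)

theorem MinDegreeTwo.le_of_adj {A B : G.Subgraph} (hA : MinDegreeTwo A)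
    (h : ∀ v w, A.Adj v w → B.Adj v w) : A ≤ B :=
  ⟨fun v hv => let ⟨w, hw, _⟩ := hA v hv; B.edge_vert (h v w hw), fun {v w} => h v w⟩

/-- By `pairCell_inj`, each square of `A × B` matches its sides with `A'` and `B'` in one of two
orders. As `A'` and `B'` share no edge, one square fixes the order for all; edges suffice since
thick subgraphs have no isolated vertex. -/
theorem productCells_subset_iff {A B A' B' : G.Subgraph} (hA : IsThick A) (hB : IsThick B)
    (hd : Disjoint A.verts B.verts) (hd' : Disjoint A'.verts B'.verts) :
    productCells A B ⊆ productCells A' B' ↔ A ≤ A' ∧ B ≤ B' ∨ A ≤ B' ∧ B ≤ A' := by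
  constructor
  swap
  · rintro (⟨h1, h2⟩ | ⟨h1, h2⟩)
    · exact productCells_mono h1 h2
    · exact productCells_comm B' A' ▸ productCells_mono h1 h2
  intro h
  have key : ∀ v w p q, A.Adj v w → B.Adj p q →
      A'.Adj v w ∧ B'.Adj p q ∨ B'.Adj v w ∧ A'.Adj p q := by
    intro v w p q hvw hpq
    have hσ : ({v, w} : Set V) ∈ subgraphCells A := Or.inr ⟨v, w, hvw, rfl⟩
    have hτ : ({p, q} : Set V) ∈ subgraphCells B := Or.inr ⟨p, q, hpq, rfl⟩
    obtain ⟨σ', hσ', τ', hτ', heq⟩ := h ⟨_, hσ, _, hτ, rfl⟩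
    rcases pairCell_inj heq
      (hd.mono (subgraphCells_subset_verts hσ) (subgraphCells_subset_verts hτ))
      (hd'.mono (subgraphCells_subset_verts hσ') (subgraphCells_subset_verts hτ'))
      (subgraphCells_nonempty hσ) (subgraphCells_nonempty hτ) with ⟨rfl, rfl⟩ | ⟨rfl, rfl⟩
    · exact Or.inl ⟨adj_of_pair_mem_subgraphCells hvw.ne hσ',
        adj_of_pair_mem_subgraphCells hpq.ne hτ'⟩
    · exact Or.inr ⟨adj_of_pair_mem_subgraphCells hvw.ne hτ',
        adj_of_pair_mem_subgraphCells hpq.ne hσ'⟩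
  have hexcl : ∀ v w, A'.Adj v w → ¬ B'.Adj v w := fun v w h1 h2 =>
    Set.disjoint_left.1 hd' (A'.edge_vert h1) (B'.edge_vert h2)
  obtain ⟨-, -, v, w, hvw⟩ := isThick_iff.1 hA
  obtain ⟨-, -, p, q, hpq⟩ := isThick_iff.1 hB
  rcases key v w p q hvw hpq with ⟨h1, h2⟩ | ⟨h1, h2⟩
  · refine Or.inl ⟨hA.minDegreeTwo.le_of_adj fun a b hab => ?_,
      hB.minDegreeTwo.le_of_adj fun a b hab => ?_⟩
    · exact (key a b p q hab hpq).elim And.left fun h => absurd h2 (hexcl p q h.2)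
    · exact (key v w a b hvw hab).elim And.right fun h => absurd h.1 (hexcl v w h1)
  · refine Or.inr ⟨hA.minDegreeTwo.le_of_adj fun a b hab => ?_,
      hB.minDegreeTwo.le_of_adj fun a b hab => ?_⟩
    · exact (key a b p q hab hpq).elim (fun h => absurd h.2 (hexcl p q h2)) And.left
    · exact (key v w a b hvw hab).elim (fun h => absurd h1 (hexcl v w h.1)) And.right

section Images

variable {W₁ W₂ : Type u} {Λ₁ : SimpleGraph W₁} {Λ₂ : SimpleGraph W₂}

theorem subgraphCells_map_top (f : Λ₁ →g G) :
    subgraphCells ((⊤ : Λ₁.Subgraph).map f) = {c | ∃ σ ∈ graphCells Λ₁, c = f '' σ} := by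
  ext c
  constructor
  · rintro (⟨_, ⟨a, -, rfl⟩, rfl⟩ | ⟨_, _, ⟨a, b, hab, rfl, rfl⟩, rfl⟩)
    · exact ⟨{a}, Or.inl ⟨a, rfl⟩, by simp⟩
    · exact ⟨{a, b}, Or.inr ⟨a, b, hab, rfl⟩, by simp [Set.image_pair]⟩
  · rintro ⟨σ, (⟨a, rfl⟩ | ⟨a, b, hab, rfl⟩), rfl⟩
    · exact Or.inl ⟨f a, ⟨a, trivial, rfl⟩, by simp⟩
    · exact Or.inr ⟨f a, f b, ⟨a, b, hab, rfl, rfl⟩, by simp [Set.image_pair]⟩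

theorem image_prod_eq_pairCell {P₁ P₂ : Type*} (f : P₁ → V) (g : P₂ → V) (σ : Set P₁)
    (τ : Set P₂) :
    (fun x : P₁ × P₂ => s(f x.1, g x.2)) '' (σ ×ˢ τ) = pairCell (f '' σ) (g '' τ) := by
  ext e
  constructor
  · rintro ⟨⟨a, b⟩, ⟨ha, hb⟩, rfl⟩
    exact ⟨f a, ⟨a, ha, rfl⟩, g b, ⟨b, hb, rfl⟩, rfl⟩
  · rintro ⟨_, ⟨a, ha, rfl⟩, _, ⟨b, hb, rfl⟩, rfl⟩
    exact ⟨(a, b), ⟨ha, hb⟩, rfl⟩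

theorem imageCells_prodComplex (f : Λ₁ →g G) (g : Λ₂ →g G) :
    imageCells (prodComplex Λ₁ Λ₂) (fun x => s(f x.1, g x.2)) =
      productCells ((⊤ : Λ₁.Subgraph).map f) ((⊤ : Λ₂.Subgraph).map g) := by
  ext c
  simp only [imageCells, productCells, subgraphCells_map_top]
  constructor
  · rintro ⟨_, ⟨σ, hσ, τ, hτ, rfl⟩, rfl⟩
    exact ⟨_, ⟨σ, hσ, rfl⟩, _, ⟨τ, hτ, rfl⟩, image_prod_eq_pairCell f g σ τ⟩
  · rintro ⟨_, ⟨σ, hσ, rfl⟩, _, ⟨τ, hτ, rfl⟩, rfl⟩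
    exact ⟨_, ⟨σ, hσ, τ, hτ, rfl⟩, (image_prod_eq_pairCell f g σ τ).symm⟩

theorem isThick_map_top {f : Λ₁ →g G} (hf : Function.Injective f) (hc : Λ₁.Connected)
    (hn : Nontriv Λ₁) (hl : Leafless Λ₁) : IsThick ((⊤ : Λ₁.Subgraph).map f) := by
  refine isThick_iff.2 ⟨?_, ?_, ?_⟩
  · rintro _ ⟨_, ⟨a, b, hab, rfl, rfl⟩, huniq⟩
    exact hl a ⟨b, hab, fun c hac => hf (huniq (f c) ⟨a, c, hac, rfl, rfl⟩)⟩
  · let g : Λ₁ →g ((⊤ : Λ₁.Subgraph).map f).coe :=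
      ⟨fun a => ⟨f a, a, trivial, rfl⟩, fun {a b} hab => ⟨a, b, hab, rfl, rfl⟩⟩
    refine ⟨hc.map g ?_⟩
    rintro ⟨_, a, -, rfl⟩
    exact ⟨a, rfl⟩
  · obtain ⟨a, b, hab⟩ := hn
    exact ⟨f a, f b, a, b, hab, rfl, rfl⟩

theorem ncard_prod_cell {a a' : W₁} {b b' : W₂} (ha : a ≠ a') (hb : b ≠ b') :
    (({a, a'} : Set W₁) ×ˢ ({b, b'} : Set W₂)).ncard = 4 := by
  rw [Set.ncard_prod, Set.ncard_pair ha, Set.ncard_pair hb]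

theorem square_mem_prodComplex {a a' : W₁} {b b' : W₂} (ha : Λ₁.Adj a a') (hb : Λ₂.Adj b b') :
    ({a, a'} : Set W₁) ×ˢ ({b, b'} : Set W₂) ∈ (prodComplex Λ₁ Λ₂).cells :=
  ⟨_, Or.inr ⟨a, a', ha, rfl⟩, _, Or.inr ⟨b, b', hb, rfl⟩, rfl⟩

theorem edge_prodComplex_left {a a' : W₁} (b : W₂) (ha : Λ₁.Adj a a') :
    (prodComplex Λ₁ Λ₂).Edge (a, b) (a', b) :=
  ⟨by simp [ha.ne], _, Or.inr ⟨a, a', ha, rfl⟩, _, Or.inl ⟨b, rfl⟩, by ext ⟨x, y⟩; simp; tauto⟩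

theorem edge_prodComplex_right (a : W₁) {b b' : W₂} (hb : Λ₂.Adj b b') :
    (prodComplex Λ₁ Λ₂).Edge (a, b) (a, b') :=
  ⟨by simp [hb.ne], _, Or.inl ⟨a, rfl⟩, _, Or.inr ⟨b, b', hb, rfl⟩, by ext ⟨x, y⟩; simp; tauto⟩

theorem edge_prodComplex_cases {x y : W₁ × W₂} (h : (prodComplex Λ₁ Λ₂).Edge x y) :
    (Λ₁.Adj x.1 y.1 ∧ x.2 = y.2) ∨ (x.1 = y.1 ∧ Λ₂.Adj x.2 y.2) := by
  obtain ⟨hne, hcell⟩ := h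
  rcases prod_shape_aux Λ₁ Λ₂ hcell (Set.ncard_pair hne) with
    ⟨v, p, q, hpq, heq⟩ | ⟨v, p, q, hpq, heq⟩
  · rcases Set.pair_eq_pair_iff.1 heq with ⟨rfl, rfl⟩ | ⟨rfl, rfl⟩
    · exact Or.inr ⟨rfl, hpq⟩
    · exact Or.inr ⟨rfl, hpq.symm⟩
  · rcases Set.pair_eq_pair_iff.1 heq with ⟨rfl, rfl⟩ | ⟨rfl, rfl⟩
    · exact Or.inl ⟨hpq, rfl⟩
    · exact Or.inl ⟨hpq.symm, rfl⟩

theorem UD₂_square_cases {c : Set (Sym2 V)} (hc : c ∈ (UD₂ G).cells) (h4 : c.ncard = 4) :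
    ∃ v w p q, G.Adj v w ∧ G.Adj p q ∧ Disjoint ({v, w} : Set V) {p, q} ∧
      c = pairCell {v, w} {p, q} := by
  obtain ⟨σ, hσ, τ, hτ, hd, rfl⟩ := hc
  rcases hσ with ⟨v, rfl⟩ | ⟨v, w, hvw, rfl⟩ <;> rcases hτ with ⟨p, rfl⟩ | ⟨p, q, hpq, rfl⟩
  · simp [pairCell_singleton] at h4
  · rw [pairCell_edge] at h4
    have := Set.ncard_insert_le s(v, p) {s(v, q)}
    simp at this; omega
  · rw [pairCell_comm, pairCell_edge] at h4
    have := Set.ncard_insert_le s(p, v) {s(p, w)}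
    simp at this; omega
  · exact ⟨v, w, p, q, hvw, hpq, hd, rfl⟩

theorem UD₂_edge_cases {e e' : Sym2 V} (h : (UD₂ G).Edge e e') :
    ∃ v p q, G.Adj p q ∧ v ≠ p ∧ v ≠ q ∧ e = s(v, p) ∧ e' = s(v, q) := by
  obtain ⟨v, p, q, hpq, h1, h2, heq⟩ := config_shape_aux G h.2 (Set.ncard_pair h.1)
  rcases Set.pair_eq_pair_iff.1 heq with ⟨rfl, rfl⟩ | ⟨rfl, rfl⟩
  · exact ⟨v, p, q, hpq, h1, h2, rfl, rfl⟩
  · exact ⟨v, q, p, hpq.symm, h2, h1, rfl, rfl⟩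

/-- In a square with one point at `b`, the other point is confined to the two ends of one edge,
which leaves no room for three positions. -/
theorem UD₂_not_linkAdj {x y z b : V} (hxy : x ≠ y) (hxz : x ≠ z) (hyz : y ≠ z) :
    ¬ (UD₂ G).LinkAdj s(x, b) s(y, b) s(z, b) := by
  rintro ⟨-, -, -, c, hc, h4, h1, h2, h3⟩
  obtain ⟨v, w, p, q, hvw, hpq, hd, rfl⟩ := UD₂_square_cases hc h4
  rw [mk_mem_pairCell] at h1 h2 h3
  simp only [Set.mem_insert_iff, Set.mem_singleton_iff] at h1 h2 h3
  simp at hd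
  grind

theorem ne_of_singleton_mem_configCells {x y : V} (h : {s(x, y)} ∈ (UD₂ G).cells) : x ≠ y := by
  rintro rfl
  obtain ⟨σ, -, τ, -, hd, heq⟩ := h
  have : s(x, x) ∈ pairCell σ τ := heq ▸ rfl
  rcases mk_mem_pairCell.1 this with h | h
  · exact Set.disjoint_left.1 hd h.1 h.2
  · exact Set.disjoint_left.1 hd h.2 h.1

/-- Disjointness makes `(a, b) ↦ s(a, b)` injective on `A × B`. Its image on links is induced: two
edges in the same factor never span a square, and two in different factors already span one in `A ×
B`. -/
theorem isStandardProduct_productCells {A B : G.Subgraph} (hA : IsThick A) (hB : IsThick B)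
    (hd : Disjoint A.verts B.verts) : IsStandardProduct (UD₂ G) (productCells A B) := by
  have hne : ∀ (a : A.verts) (b : B.verts), (a : V) ≠ b := fun a b h =>
    Set.disjoint_left.1 hd a.2 (h ▸ b.2)
  set ι : A.verts × B.verts → Sym2 V := fun x => s(A.hom x.1, B.hom x.2) with hι
  have hinj : Function.Injective ι := by
    rintro ⟨a, b⟩ ⟨a', b'⟩ h
    rcases Sym2.eq_iff.1 h with ⟨h1, h2⟩ | ⟨h1, h2⟩
    · exact Prod.ext (Subtype.ext h1) (Subtype.ext h2)
    · exact absurd h1 (hne a b')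
  have himage := imageCells_prodComplex A.hom B.hom
  rw [SimpleGraph.Subgraph.map_hom_top, SimpleGraph.Subgraph.map_hom_top] at himage
  have hnontriv : ∀ {H : G.Subgraph}, IsThick H → Nontriv H.coe := fun {H} hH => by
    obtain ⟨-, -, v, w, hvw⟩ := isThick_iff.1 hH
    exact ⟨⟨v, H.edge_vert hvw⟩, ⟨w, H.edge_vert hvw.symm⟩, hvw⟩
  have hleafless : ∀ {H : G.Subgraph}, IsThick H → Leafless H.coe := fun {H} hH => by
    rintro v ⟨w, hw, huniq⟩
    exact hH.minDegreeTwo.leafless v ⟨w, hw, fun y hy =>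
      congrArg Subtype.val (huniq ⟨y, H.edge_vert hy.symm⟩ hy)⟩
  refine ⟨A.verts, B.verts, A.coe, B.coe, ι, ⟨hA.connected.coe, hB.connected.coe, hnontriv hA,
    hnontriv hB, ⟨?_, ?_, ?_⟩, ?_⟩, hleafless hA, hleafless hB, himage.symm⟩
  · intro c hc
    refine ⟨hinj.injOn, ?_⟩
    have hmem : ι '' c ∈ productCells A B := himage ▸ ⟨c, hc, rfl⟩
    obtain ⟨σ, hσ, τ, hτ, heq⟩ := hmem
    exact ⟨σ, subgraphCells_subset_graphCells A hσ, τ, subgraphCells_subset_graphCells B hτ,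
      hd.mono (subgraphCells_subset_verts hσ) (subgraphCells_subset_verts hτ), heq⟩
  · exact fun x y z _ _ h => hinj h
  · rintro ⟨a, b⟩ ⟨a', b'⟩ ⟨a'', b''⟩ hy hz hlink
    have hyz : ((a', b') : A.verts × B.verts) ≠ (a'', b'') := fun h => hlink.1 (congrArg ι h)
    refine ⟨hyz, hy, hz, ?_⟩
    rcases edge_prodComplex_cases hy with ⟨h1, h2⟩ | ⟨h1, h2⟩ <;>
      rcases edge_prodComplex_cases hz with ⟨h3, h4⟩ | ⟨h3, h4⟩ <;>
      dsimp only at h1 h2 h3 h4 <;> subst_vars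
    · exact absurd hlink (UD₂_not_linkAdj (fun h => h1.ne (Subtype.ext h))
        (fun h => h3.ne (Subtype.ext h)) (fun h => hyz (Prod.ext (Subtype.ext h) rfl)))
    · exact ⟨_, square_mem_prodComplex h1 h4, ncard_prod_cell h1.ne h4.ne, by simp, by simp,
        by simp⟩
    · exact ⟨_, square_mem_prodComplex h3 h2, ncard_prod_cell h3.ne h2.ne, by simp, by simp,
        by simp⟩
    · simp only [hι, Sym2.eq_swap (a := A.hom _)] at hlink
      exact absurd hlink (UD₂_not_linkAdj (fun h => h2.ne (Subtype.ext h))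
        (fun h => h4.ne (Subtype.ext h)) (fun h => hyz (Prod.ext rfl (Subtype.ext h))))
  · obtain ⟨a, ha⟩ := hA.connected.nonempty
    obtain ⟨b, hb⟩ := hB.connected.nonempty
    exact ⟨⟨a, ha⟩, ⟨b, hb⟩, fun x y h => congrArg Prod.fst (hinj h),
      fun x y h => congrArg Prod.snd (hinj h)⟩

theorem IsCombinatorial.edge {P Q : Type u} {X : SquareComplex P} {Y : SquareComplex Q}
    {φ : P → Q} (h : IsCombinatorial X Y φ) {x y : P} (hxy : X.Edge x y) :
    Y.Edge (φ x) (φ y) := by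
  obtain ⟨hinj, hmem⟩ := h _ hxy.2
  refine ⟨fun he => hxy.1 (hinj (by simp) (by simp) he), ?_⟩
  rwa [Set.image_pair] at hmem

/-- A combinatorial map from a product to the configuration space sends the two directions of a
square to disjoint edges of the graph. -/
theorem IsCombinatorial.square {ι : W₁ × W₂ → Sym2 V}
    (h : IsCombinatorial (prodComplex Λ₁ Λ₂) (UD₂ G) ι) {a a' : W₁} {b b' : W₂}
    (ha : Λ₁.Adj a a') (hb : Λ₂.Adj b b') :
    ∃ v w p q, G.Adj v w ∧ G.Adj p q ∧ Disjoint ({v, w} : Set V) {p, q} ∧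
      ι (a, b) = s(v, p) ∧ ι (a', b) = s(w, p) ∧ ι (a, b') = s(v, q) ∧ ι (a', b') = s(w, q) := by
  obtain ⟨hinj, hmem⟩ := h _ (square_mem_prodComplex ha hb)
  have h4 : (ι '' (({a, a'} : Set W₁) ×ˢ ({b, b'} : Set W₂))).ncard = 4 := by
    rw [hinj.ncard_image, ncard_prod_cell ha.ne hb.ne]
  have hsub : ∀ x y, x ∈ ({a, a'} : Set W₁) → y ∈ ({b, b'} : Set W₂) →
      ι (x, y) ∈ ι '' (({a, a'} : Set W₁) ×ˢ ({b, b'} : Set W₂)) := fun x y hx hy =>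
    ⟨(x, y), ⟨hx, hy⟩, rfl⟩
  have m1 := hsub a b (by simp) (by simp)
  have m2 := hsub a' b (by simp) (by simp)
  have m3 := hsub a b' (by simp) (by simp)
  have m4 := hsub a' b' (by simp) (by simp)
  have n14 : ι (a, b) ≠ ι (a', b') := fun he =>
    ha.ne (congrArg Prod.fst (hinj (by simp) (by simp) he))
  have n24 := (h.edge (edge_prodComplex_right a' hb)).1
  have n34 := (h.edge (edge_prodComplex_left b' ha)).1
  have n23 : ι (a', b) ≠ ι (a, b') := fun he =>
    ha.ne (congrArg Prod.fst (hinj (by simp) (by simp) he)).symm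
  obtain ⟨v₁, p₁, q₁, -, -, -, e₁, e₁'⟩ := UD₂_edge_cases (h.edge (edge_prodComplex_left b ha))
  obtain ⟨v₂, p₂, q₂, -, -, -, e₂, e₂'⟩ := UD₂_edge_cases (h.edge (edge_prodComplex_right a hb))
  have n12 := (h.edge (edge_prodComplex_left b ha)).1
  have n13 := (h.edge (edge_prodComplex_right a hb)).1
  obtain ⟨v, w, p, q, hvw, hpq, hd, hcell⟩ := UD₂_square_cases hmem h4
  rw [hcell] at m1 m2 m3 m4
  clear hcell h4 hsub hinj hmem
  -- The ends of the two edges are relabelled so that the corner `(a, b)` goes to `s(v, p)`.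
  have base : ∃ v w p q, G.Adj v w ∧ G.Adj p q ∧ Disjoint ({v, w} : Set V) {p, q} ∧
      ι (a, b) = s(v, p) ∧ ι (a', b) ∈ pairCell {v, w} {p, q} ∧
      ι (a, b') ∈ pairCell {v, w} {p, q} ∧ ι (a', b') ∈ pairCell {v, w} {p, q} := by
    have hw : ({w, v} : Set V) = {v, w} := Set.pair_comm w v
    have hq : ({q, p} : Set V) = {p, q} := Set.pair_comm q p
    rw [pairCell_square] at m1
    rcases m1 with m1 | m1 | m1 | m1
    · exact ⟨v, w, p, q, hvw, hpq, hd, m1, m2, m3, m4⟩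
    · exact ⟨w, v, p, q, hvw.symm, hpq, hw ▸ hd, m1, hw ▸ m2, hw ▸ m3, hw ▸ m4⟩
    · exact ⟨w, v, q, p, hvw.symm, hpq.symm, hw ▸ hq ▸ hd, m1, hw ▸ hq ▸ m2,
        hw ▸ hq ▸ m3, hw ▸ hq ▸ m4⟩
    · exact ⟨v, w, q, p, hvw, hpq.symm, hq ▸ hd, m1, hq ▸ m2, hq ▸ m3, hq ▸ m4⟩
  clear m1 m2 m3 m4 hd hvw hpq v w p q
  obtain ⟨v, w, p, q, hvw, hpq, hd, m1, m2, m3, m4⟩ := base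
  have hd' := hd
  simp only [Set.disjoint_insert_left, Set.disjoint_singleton_left, Set.mem_insert_iff,
    Set.mem_singleton_iff, not_or] at hd'
  obtain ⟨⟨d1, d2⟩, d3, d4⟩ := hd'
  rw [m1] at e₁ e₂ n12 n13 n14
  rw [pairCell_square] at m2 m3 m4
  simp only [Set.mem_insert_iff, Set.mem_singleton_iff] at m2 m3 m4
  have hvw' := hvw.ne
  have hpq' := hpq.ne
  -- The opposite corner `s(w, q)` is excluded because neighbours in the configuration space share a
  -- point.
  have c2 : ι (a', b) = s(w, p) ∨ ι (a', b) = s(v, q) := by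
    rcases m2 with m | m | m | m
    · exact absurd m.symm n12
    · exact Or.inl m
    · rw [m] at e₁'
      rw [Sym2.eq_iff] at e₁ e₁'
      grind
    · exact Or.inr m
  have c3 : ι (a, b') = s(w, p) ∨ ι (a, b') = s(v, q) := by
    rcases m3 with m | m | m | m
    · exact absurd m.symm n13
    · exact Or.inl m
    · rw [m] at e₂'
      rw [Sym2.eq_iff] at e₂ e₂'
      grind
    · exact Or.inr m
  rcases c2 with c2 | c2 <;> rcases c3 with c3 | c3
  · exact absurd (c2.trans c3.symm) n23
  · have c4 : ι (a', b') = s(w, q) := by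
      rcases m4 with m | m | m | m
      · exact absurd m.symm n14
      · exact absurd (c2.trans m.symm) n24
      · exact m
      · exact absurd (c3.trans m.symm) n34
    exact ⟨v, w, p, q, hvw, hpq, hd, m1, c2, c3, c4⟩
  · have c4 : ι (a', b') = s(w, q) := by
      rcases m4 with m | m | m | m
      · exact absurd m.symm n14
      · exact absurd (c3.trans m.symm) n34
      · exact m
      · exact absurd (c2.trans m.symm) n24
    exact ⟨p, q, v, w, hpq, hvw, hd.symm, m1.trans Sym2.eq_swap, c2.trans Sym2.eq_swap,
      c3.trans Sym2.eq_swap, c4.trans Sym2.eq_swap⟩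
  · exact absurd (c2.trans c3.symm) n23

end Images

end Products

end GraphBraid

namespace GraphBraid

/-! ### Classification of the standard product subcomplexes. -/

section Classification

variable {V : Type u} {G : SimpleGraph V}
variable {W₁ W₂ : Type u} {Λ₁ : SimpleGraph W₁} {Λ₂ : SimpleGraph W₂} {ι : W₁ × W₂ → Sym2 V}

/-- An edge of the second factor moves the same point along the same edge, wherever the other
point is. -/
theorem IsCombinatorial.parallel (h : IsCombinatorial (prodComplex Λ₁ Λ₂) (UD₂ G) ι)
    (hc : Λ₁.Connected) {a₀ : W₁} {b b' : W₂} (hb : Λ₂.Adj b b') {v₀ p q : V}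
    (h1 : ι (a₀, b) = s(v₀, p)) (h2 : ι (a₀, b') = s(v₀, q)) (a : W₁) :
    ∃ v, ι (a, b) = s(v, p) ∧ ι (a, b') = s(v, q) := by
  have hpq : p ≠ q := fun he =>
    (h.edge (edge_prodComplex_right a₀ hb)).1 (h1.trans (he ▸ h2.symm))
  obtain ⟨walk⟩ := hc.preconnected a₀ a
  induction walk generalizing v₀ with
  | nil => exact ⟨v₀, h1, h2⟩
  | cons ha _ ih =>
    obtain ⟨v, w, p', q', hvw, hpq', hd, e1, e2, e3, e4⟩ := h.square ha hb
    simp only [Set.disjoint_insert_left, Set.disjoint_singleton_left, Set.mem_insert_iff,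
      Set.mem_singleton_iff, not_or] at hd
    rw [h1, Sym2.eq_iff] at e1
    rw [h2, Sym2.eq_iff] at e3
    -- As `p ≠ q`, the two pairs determine which point stays and which one moves.
    have hp : p' = p ∧ q' = q := by grind
    obtain ⟨rfl, rfl⟩ := hp
    exact ih e2 e4

/-- A combinatorial map from a product of connected graphs to the configuration space moves the
two points independently. -/
theorem IsCombinatorial.exists_eq_mk (h : IsCombinatorial (prodComplex Λ₁ Λ₂) (UD₂ G) ι)
    (hc₁ : Λ₁.Connected) (hc₂ : Λ₂.Connected) (hn₁ : Nontriv Λ₁) (hn₂ : Nontriv Λ₂) :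
    ∃ (f : W₁ → V) (g : W₂ → V), ∀ a b, ι (a, b) = s(f a, g b) := by
  obtain ⟨a₀, a₁, ha⟩ := hn₁
  obtain ⟨b₀, b₁, hb⟩ := hn₂
  obtain ⟨v₀, -, p₀, q₀, -, -, -, e1, -, e3, -⟩ := h.square ha hb
  -- `f a` is the point that stays put while the other traverses the image of the edge `b₀ b₁`.
  choose f hf using h.parallel hc₁ hb e1 e3
  have hstep : ∀ b, ∃ p, ∀ a, ι (a, b) = s(f a, p) := by
    intro b
    obtain ⟨walk⟩ := hc₂.preconnected b b₀
    induction walk with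
    | nil => exact ⟨p₀, fun a => (hf a).1⟩
    | @cons b' b c hbb _ ih =>
      obtain ⟨p, hp⟩ := ih hb e1 hf
      have hne : f a₀ ≠ f a₁ := fun he =>
        (h.edge (edge_prodComplex_left b ha)).1 (by rw [hp, hp, he])
      obtain ⟨v, w, p', q, hvw, hpq, hd, d1, d2, d3, -⟩ := h.square ha hbb.symm
      simp only [Set.disjoint_insert_left, Set.disjoint_singleton_left, Set.mem_insert_iff,
        Set.mem_singleton_iff, not_or] at hd
      have d1' := d1
      rw [hp, Sym2.eq_iff] at d1 d2
      -- Along `a₀ a₁` the point at `p` is stationary, because `f a₀ ≠ f a₁`; so the edge of `Λ₂`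
      -- moves `p`, and `parallel` spreads this to all `a`.
      have hv : v = f a₀ ∧ p' = p := by grind
      obtain ⟨rfl, rfl⟩ := hv
      refine ⟨q, fun a => ?_⟩
      obtain ⟨v', h1, h2⟩ := h.parallel hc₁ hbb.symm d1' d3 a
      rw [hp, Sym2.congr_left] at h1
      rw [h2, h1]
  choose g hg using hstep
  exact ⟨f, g, fun a b => hg b a⟩

theorem UD₂_adj_of_edge {x y z : V} (h : (UD₂ G).Edge s(x, z) s(y, z)) : G.Adj x y := by
  have hne : x ≠ y := fun he => h.1 (he ▸ rfl)
  obtain ⟨v, p, q, hpq, h1, h2, e, e'⟩ := UD₂_edge_cases h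
  have hsymm := hpq.symm
  rw [Sym2.eq_iff] at e e'
  grind

/-- The standard product subcomplexes of the configuration space are the products of pairs of
disjoint thick subgraphs. -/
theorem isStandardProduct_UD₂_iff {K : Set (Set (Sym2 V))} :
    IsStandardProduct (UD₂ G) K ↔ ∃ A B : G.Subgraph, IsThick A ∧ IsThick B ∧
      Disjoint A.verts B.verts ∧ K = productCells A B := by
  constructor
  swap
  · rintro ⟨A, B, hA, hB, hd, rfl⟩
    exact isStandardProduct_productCells hA hB hd
  rintro ⟨W₁, W₂, Λ₁, Λ₂, ι, ⟨hc₁, hc₂, hn₁, hn₂, hloc, a₀, b₀, hi₁, hi₂⟩, hl₁, hl₂, rfl⟩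
  have hcomb := hloc.combinatorial
  obtain ⟨f, g, hfg⟩ := hcomb.exists_eq_mk hc₁ hc₂ hn₁ hn₂
  obtain rfl : ι = fun x => s(f x.1, g x.2) := funext fun x => hfg x.1 x.2
  let F : Λ₁ →g G := ⟨f, fun {a a'} haa => UD₂_adj_of_edge (hcomb.edge
    (edge_prodComplex_left b₀ haa))⟩
  let E : Λ₂ →g G := ⟨g, fun {b b'} hbb => UD₂_adj_of_edge (z := f a₀) (by
    have := hcomb.edge (edge_prodComplex_right a₀ hbb)
    rwa [Sym2.eq_swap, Sym2.eq_swap (b := g b')] at this)⟩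
  -- One injective slice in each direction suffices, since the map splits as `s(f a, g b)`.
  have hF : Function.Injective F := fun a a' he => hi₁ (congrArg (fun x => s(x, g b₀)) he)
  have hE : Function.Injective E := fun b b' he => hi₂ (congrArg (fun x => s(f a₀, x)) he)
  refine ⟨(⊤ : Λ₁.Subgraph).map F, (⊤ : Λ₂.Subgraph).map E, isThick_map_top hF hc₁ hn₁ hl₁,
    isThick_map_top hE hc₂ hn₂ hl₂, Set.disjoint_left.2 ?_, imageCells_prodComplex F E⟩
  -- A common vertex `x` of the two images would make `s(x, x)` a vertex of the configuration space.
  rintro _ ⟨a, -, rfl⟩ ⟨b, -, he⟩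
  have hcell := (hcomb {(a, b)} ((prodComplex Λ₁ Λ₂).vertex_mem {(a, b)}
    ⟨{a}, Or.inl ⟨a, rfl⟩, {b}, Or.inl ⟨b, rfl⟩, by simp⟩ _ rfl)).2
  rw [Set.image_singleton] at hcell
  exact ne_of_singleton_mem_configCells hcell he.symm

end Classification

/-! ### Maximal products and the intersection complex. -/

section IntersectionComplex

variable {V : Type u} {G : SimpleGraph V}

/-- The product of a subgraph with its orthogonal complement. -/
def orthoProduct (M : G.Subgraph) : Set (Set (Sym2 V)) := productCells M (ortho M)

theorem orthoProduct_ortho {M : G.Subgraph} (hM : IsMaximallyStandard M) :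
    orthoProduct (ortho M) = orthoProduct M := by
  rw [orthoProduct, hM.ortho_ortho, productCells_comm, orthoProduct]

theorem IsMaximallyStandard.isStandardProduct {M : G.Subgraph} (hM : IsMaximallyStandard M) :
    IsStandardProduct (UD₂ G) (orthoProduct M) :=
  isStandardProduct_productCells hM.1.isThick hM.2.isThick (disjoint_verts_ortho M).symm

theorem productCells_subset_orthoProduct_iff {A B M : G.Subgraph} (hA : IsThick A)
    (hB : IsThick B) (hd : Disjoint A.verts B.verts) :
    productCells A B ⊆ orthoProduct M ↔
      A ≤ M ∧ B ≤ ortho M ∨ A ≤ ortho M ∧ B ≤ M :=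
  productCells_subset_iff hA hB hd (disjoint_verts_ortho M).symm

variable [Finite V]

/-- One factor gives an inclusion, and taking complements of the inclusion of the other factor
reverses it. -/
theorem eq_or_eq_ortho_of_orthoProduct_subset {M N : G.Subgraph} (hM : IsMaximallyStandard M)
    (hN : IsMaximallyStandard N) (h : orthoProduct M ⊆ orthoProduct N) :
    M = N ∨ M = ortho N := by
  rcases (productCells_subset_orthoProduct_iff hM.1.isThick hM.2.isThick
    (disjoint_verts_ortho M).symm).1 h with ⟨h1, h2⟩ | ⟨h1, h2⟩
  · have := ortho_anti h2.1
    rw [hM.ortho_ortho, hN.ortho_ortho] at this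
    exact Or.inl (le_antisymm h1 this)
  · have := ortho_anti h2.1
    rw [hM.ortho_ortho] at this
    exact Or.inr (le_antisymm h1 this)

theorem orthoProduct_eq_of_subset {M N : G.Subgraph} (hM : IsMaximallyStandard M)
    (hN : IsMaximallyStandard N) (h : orthoProduct M ⊆ orthoProduct N) :
    orthoProduct M = orthoProduct N := by
  rcases eq_or_eq_ortho_of_orthoProduct_subset hM hN h with rfl | rfl
  · rfl
  · exact orthoProduct_ortho hN

theorem IsStandardProduct.exists_subset_orthoProduct (hG : G.Connected)
    {K : Set (Set (Sym2 V))} (hK : IsStandardProduct (UD₂ G) K) :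
    ∃ M : {H : G.Subgraph // IsMaximallyStandard H}, K ⊆ orthoProduct M.1 := by
  obtain ⟨A, B, hA, hB, hd, rfl⟩ := isStandardProduct_UD₂_iff.1 hK
  obtain ⟨M, h1, h2⟩ := exists_isMaximallyStandard_of_isThick hG hA hB hd
  exact ⟨M, productCells_mono h1 h2⟩

/-- Every standard product lies in some `orthoProduct M`, and no inclusion between two of these is
strict. -/
theorem maximal_isStandardProduct_iff (hG : G.Connected) {K : Set (Set (Sym2 V))} :
    Maximal (IsStandardProduct (UD₂ G)) K ↔
      ∃ M : {H : G.Subgraph // IsMaximallyStandard H}, K = orthoProduct M.1 := by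
  constructor
  · intro hK
    obtain ⟨M, hM⟩ := hK.1.exists_subset_orthoProduct hG
    exact ⟨M, hM.antisymm (hK.2 M.2.isStandardProduct hM)⟩
  · rintro ⟨M, rfl⟩
    refine ⟨M.2.isStandardProduct, fun K hK hle => ?_⟩
    obtain ⟨N, hN⟩ := hK.exists_subset_orthoProduct hG
    exact hN.trans (orthoProduct_eq_of_subset M.2 N.2 (hle.trans hN)).ge

/-- By finiteness `K` enlarges to a maximal common standard product, which is the core of a simplex
on `{M, N}`. -/
theorem reachable_intersectionSkeleton {M N : MaximalProduct (UD₂ G)} {K : Set (Set (Sym2 V))}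
    (hK : IsStandardProduct (UD₂ G) K) (hM : K ⊆ M.1) (hN : K ⊆ N.1) :
    (intersectionSkeleton (UD₂ G)).Reachable M N := by
  obtain ⟨C, -, hC⟩ := (Set.toFinite {K : Set (Set (Sym2 V)) | IsStandardProduct (UD₂ G) K ∧
    ∀ L ∈ ({M, N} : Set (MaximalProduct (UD₂ G))), K ⊆ L.1}).exists_le_maximal
    (a := K) ⟨hK, by rintro _ (rfl | rfl) <;> assumption⟩
  exact reachable_fromRel ⟨⟨{M, N}, Set.toFinite _, Set.insert_nonempty _ _, C, hC⟩, rfl⟩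

theorem reachable_maximallyStandardGraph_of_orthoProduct_eq
    (M N : {H : G.Subgraph // IsMaximallyStandard H})
    (h : orthoProduct M.1 = orthoProduct N.1) : (maximallyStandardGraph G).Reachable M N := by
  rcases eq_or_eq_ortho_of_orthoProduct_subset M.2 N.2 h.subset with h | h
  · exact reachable_maximallyStandardGraph_of_le M N h.le
  · exact reachable_maximallyStandardGraph_ortho M N h.le

/-- Replacing `M` or `N` by its complement if necessary, both contain the thick factor `A` of `K`.
-/
theorem reachable_maximallyStandardGraph_of_common_product (hG : G.Connected)
    (M N : {H : G.Subgraph // IsMaximallyStandard H}) {K : Set (Set (Sym2 V))}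
    (hK : IsStandardProduct (UD₂ G) K) (hM : K ⊆ orthoProduct M.1)
    (hN : K ⊆ orthoProduct N.1) : (maximallyStandardGraph G).Reachable M N := by
  obtain ⟨A, B, hA, hB, hd, rfl⟩ := isStandardProduct_UD₂_iff.1 hK
  have key : ∀ L : {H : G.Subgraph // IsMaximallyStandard H},
      productCells A B ⊆ orthoProduct L.1 →
      ∃ L' : {H : G.Subgraph // IsMaximallyStandard H}, A ≤ L'.1 ∧
        (maximallyStandardGraph G).Reachable L L' := by
    intro L hL
    rcases (productCells_subset_orthoProduct_iff hA hB hd).1 hL with ⟨h, -⟩ | ⟨h, -⟩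
    · exact ⟨L, h, SimpleGraph.Reachable.refl _⟩
    · exact ⟨IsMaximallyStandard.perp L, h, (reachable_maximallyStandardGraph_ortho
        (IsMaximallyStandard.perp L) L le_rfl).symm⟩
  obtain ⟨M', hM', hMM⟩ := key M hM
  obtain ⟨N', hN', hNN⟩ := key N hN
  exact (hMM.trans (reachable_maximallyStandardGraph_of_ge hG hA M' N' hM' hN')).trans hNN.symm

/-- The maximal product subcomplex defined by a maximally standard subgraph. -/
def MaximalProduct.ofMaximallyStandard (hG : G.Connected)
    (M : {H : G.Subgraph // IsMaximallyStandard H}) : MaximalProduct (UD₂ G) :=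
  ⟨orthoProduct M.1, (maximal_isStandardProduct_iff hG).2 ⟨M, rfl⟩⟩

/-- The product of `M` with `ortho N` lies in both maximal products. -/
theorem reachable_ofMaximallyStandard_of_le (hG : G.Connected)
    (M N : {H : G.Subgraph // IsMaximallyStandard H}) (h : M.1 ≤ N.1) :
    (intersectionSkeleton (UD₂ G)).Reachable (MaximalProduct.ofMaximallyStandard hG M)
      (MaximalProduct.ofMaximallyStandard hG N) := by
  have hN := N.2.2.isThick
  have hle : ortho N.1 ≤ ortho M.1 := ortho_anti h.1
  exact reachable_intersectionSkeleton (isStandardProduct_productCells M.2.1.isThick hN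
    ((disjoint_verts_ortho M.1).symm.mono_right hle.1))
    (productCells_mono le_rfl hle) (productCells_mono h le_rfl)

theorem reachable_ofMaximallyStandard (hG : G.Connected)
    (M N : {H : G.Subgraph // IsMaximallyStandard H}) (h : M.1 ≤ N.1 ⊔ ortho N.1) :
    (intersectionSkeleton (UD₂ G)).Reachable (MaximalProduct.ofMaximallyStandard hG M)
      (MaximalProduct.ofMaximallyStandard hG N) := by
  rcases M.2.1.isThick.le_or_le_ortho h with h | h
  · exact reachable_ofMaximallyStandard_of_le hG M N h
  -- Since `N` and `ortho N` define the same product, the orthogonal case reduces to an inclusion.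
  · have heq : MaximalProduct.ofMaximallyStandard hG (IsMaximallyStandard.perp N) =
        MaximalProduct.ofMaximallyStandard hG N := Subtype.ext (orthoProduct_ortho N.2)
    exact heq ▸ reachable_ofMaximallyStandard_of_le hG M (IsMaximallyStandard.perp N) h

theorem maximallyStandardGraph_preconnected_iff (hG : G.Connected) :
    (maximallyStandardGraph G).Preconnected ↔
      (intersectionSkeleton (UD₂ G)).Preconnected := by
  constructor
  · refine preconnected_of_correspondence (fun M K => K.1 = orthoProduct M.1)
      (fun K => (maximal_isStandardProduct_iff hG).1 K.2) (fun M K L hK hL => ?_)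
      (fun M N h => ⟨.ofMaximallyStandard hG M, .ofMaximallyStandard hG N, rfl, rfl, ?_⟩)
    · obtain rfl : K = L := Subtype.ext (hK.trans hL.symm)
      exact SimpleGraph.Reachable.refl _
    · rcases ((SimpleGraph.fromRel_adj _ _ _).1 h).2 with h | h
      · exact reachable_ofMaximallyStandard hG M N h
      · exact (reachable_ofMaximallyStandard hG N M h).symm
  · refine preconnected_of_correspondence (fun K M => K.1 = orthoProduct M.1)
      (fun M => ⟨.ofMaximallyStandard hG M, rfl⟩) (fun K M N hM hN => ?_) (fun K L h => ?_)
    · exact reachable_maximallyStandardGraph_of_orthoProduct_eq M N (hM.symm.trans hN)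
    · obtain ⟨M, hM⟩ := (maximal_isStandardProduct_iff hG).1 K.2
      obtain ⟨N, hN⟩ := (maximal_isStandardProduct_iff hG).1 L.2
      have hcore : ∃ C, IsStandardProduct (UD₂ G) C ∧ C ⊆ K.1 ∧ C ⊆ L.1 := by
        rcases ((SimpleGraph.fromRel_adj _ _ _).1 h).2 with ⟨s, hs⟩ | ⟨s, hs⟩
        · exact ⟨s.core, s.core_maximal.1.1, s.core_maximal.1.2 K (by simp [hs]),
            s.core_maximal.1.2 L (by simp [hs])⟩
        · exact ⟨s.core, s.core_maximal.1.1, s.core_maximal.1.2 K (by simp [hs]),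
            s.core_maximal.1.2 L (by simp [hs])⟩
      obtain ⟨C, hC, hCK, hCL⟩ := hcore
      exact ⟨M, N, hM, hN, reachable_maximallyStandardGraph_of_common_product hG M N hC
        (hM ▸ hCK) (hN ▸ hCL)⟩

theorem nonempty_maximallyStandard_iff (hG : G.Connected) :
    Nonempty {H : G.Subgraph // IsMaximallyStandard H} ↔ Nonempty (MaximalProduct (UD₂ G)) :=
  ⟨fun ⟨M⟩ => ⟨.ofMaximallyStandard hG M⟩,
    fun ⟨K⟩ => ⟨((maximal_isStandardProduct_iff hG).1 K.2).choose⟩⟩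

end IntersectionComplex

end GraphBraid

/-! ### The equivalences under both conventions on the empty graph. -/

theorem mainTheorem11 {V : Type u} [Finite V] (G : SimpleGraph V) (hG : G.Connected) :
    List.TFAE
      [(GraphBraid.curveGraph G).Connected,
       (GraphBraid.standardGraph G).Connected,
       (GraphBraid.maximallyStandardGraph G).Connected,
       (GraphBraid.intersectionSkeleton (GraphBraid.UD₂ G)).Connected] ∧
    List.TFAE
      [(GraphBraid.curveGraph G).Preconnected,
       (GraphBraid.standardGraph G).Preconnected,
       (GraphBraid.maximallyStandardGraph G).Preconnected,
       (GraphBraid.intersectionSkeleton (GraphBraid.UD₂ G)).Preconnected] := by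
  have h12 := GraphBraid.curveGraph_preconnected_iff (G := G)
  have h23 := GraphBraid.standardGraph_preconnected_iff hG
  have h34 := GraphBraid.maximallyStandardGraph_preconnected_iff hG
  have c12 := GraphBraid.connected_iff_of_preconnected_iff h12 GraphBraid.nonempty_curves_iff
  have c23 := GraphBraid.connected_iff_of_preconnected_iff h23
    (GraphBraid.nonempty_standard_iff hG)
  have c34 := GraphBraid.connected_iff_of_preconnected_iff h34
    (GraphBraid.nonempty_maximallyStandard_iff hG)
  constructor
  · tfae_have 1 ↔ 2 := c12
    tfae_have 2 ↔ 3 := c23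
    tfae_have 3 ↔ 4 := c34
    tfae_finish
  · tfae_have 1 ↔ 2 := h12
    tfae_have 2 ↔ 3 := h23
    tfae_have 3 ↔ 4 := h34
    tfae_finish
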